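/- Let $\Xi$ be a locally compact (Hausdorff) abelian group with Haar measure $dx$. Let $m:\Xi\times\Xi\to S^1$ be a separately continuous multiplier, i.e. $m(x+y,z)m(x,y)=m(x,y+z)m(y,z)$ and $m(x,0)=m(0,x)=1$, which is a Heisenberg multiplier: with $\sigma(x,y)=m(x,y)/m(y,x)$, the map $x\mapsto\sigma(x,\cdot)$ is a topological isomorphism of $\Xi$ onto its Pontryagin dual $\widehat\Xi$. Assume $m(x,y)=m(-x,-y)$ for all $x,y\in\Xi$. Let $(U_x)_{x\in\Xi}$ be an irreducible, strongly continuous projective unitary representation of $\Xi$ on a complex Hilbert space $\mathcal H$ with $U_xU_y=m(x,y)U_{x+y}$, which is square integrable: $x\mapsto\langle U_x\varphi,\psi\rangle$ is in $L^2(\Xi)$ for some nonzero $\varphi,\psi\in\mathcal H$. Let $\mathcal T^1(\mathcal H)$ be the space of trace class operators on $\mathcal H$, and put $\alpha_x(A)=U_xAU_x^*$. Then there is a unitary operator $R$ on $\mathcal H$ with $U_xR=RU_{-x}$ for all $x\in\Xi$. For every such $R$, put $\beta_-(A)=RAR^*$. For $f,g\in L^1(\Xi)$ and $A,B\in\mathcal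 T^1(\mathcal H)$ the convolutions $$(f*g)(y)=\int_\Xi f(x)g(y-x)\,dx,\qquad f*A=\int_\Xi f(x)\,\alpha_x(A)\,dx,\qquad (A*B)(x)=\operatorname{tr}\bigl(A\,\alpha_x(\beta_-(B))\bigr)$$ are well defined (the first integral converges for almost every $y$, the second one as a Bochner integral of operators, and each operator $A\,\alpha_x(\beta_-(B))$ is of trace class), with $f*g\in L^1(\Xi)$, $f*A\in\mathcal T^1(\mathcal H)$, $A*B\in L^1(\Xi)$. The operation $$(f,A)*(g,B)=(f*g+A*B,\; f*B+g*A)$$ on $L^1(\Xi)\oplus\mathcal T^1(\mathcal H)$ is commutative, associative, distributive over addition on both sides, and compatible with multiplication by complex scalars in each argument. Hence $L^1(\Xi)\oplus\mathcal T^1(\mathcal H)$ is a commutative complex algebra. -/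

import Mathlib

open MeasureTheory
open scoped InnerProductSpace ENNReal Convolution

noncomputable section

namespace QHA

section TraceClass

variable (H : Type*) [NormedAddCommGroup H] [InnerProductSpace ℂ H] [CompleteSpace H]

/-- The index set of a fixed orthonormal basis of `H`. -/
def basisIndex : Set H := (exists_hilbertBasis ℂ H).choose

/-- A fixed orthonormal (Hilbert) basis of `H`. -/
def onb : HilbertBasis (basisIndex H) ℂ H := (exists_hilbertBasis ℂ H).choose_spec.choose

variable {H}

/-- `T` is of trace class if `∑ᵢ ⟨eᵢ, |T| eᵢ⟩ < ∞` for an orthonormal basis `(eᵢ)`, where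
`|T| = (T* T)^{1/2}`; the condition does not depend on the basis. -/
def IsTraceClass (T : H →L[ℂ] H) : Prop :=
  Summable fun i => (⟪onb H i, CFC.abs T (onb H i)⟫_ℂ).re

/-- The trace `∑ᵢ ⟨eᵢ, T eᵢ⟩` (used for trace class operators, for which the sum converges
absolutely and is independent of the orthonormal basis). -/
def trace (T : H →L[ℂ] H) : ℂ := ∑' i, ⟪onb H i, T (onb H i)⟫_ℂ

/-- The square of the Hilbert-Schmidt norm. -/
def hs (T : H →L[ℂ] H) : ℝ≥0∞ := ∑' i, ‖T (onb H i)‖ₑ ^ 2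

theorem parseval (x : H) : ‖x‖ₑ ^ 2 = ∑' i, ‖⟪onb H i, x⟫_ℂ‖ₑ ^ 2 := by
  have h := (onb H).hasSum_inner_mul_inner x x
  have h2 : HasSum (fun i => ‖⟪onb H i, x⟫_ℂ‖ ^ 2) (‖x‖ ^ 2) := by
    have h3 := Complex.hasSum_re h
    have e1 : (⟪x, x⟫_ℂ).re = ‖x‖ ^ 2 := by
      rw [inner_self_eq_norm_sq_to_K]; norm_cast
    rw [e1] at h3
    refine h3.congr_fun ?_ |> fun h => h
    intro i
    rw [← inner_conj_symm x, ← Complex.normSq_eq_conj_mul_self, Complex.ofReal_re,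
      Complex.normSq_eq_norm_sq]
  have h4 := ENNReal.ofReal_tsum_of_nonneg (fun i => sq_nonneg ‖⟪onb H i, x⟫_ℂ‖) h2.summable
  rw [h2.tsum_eq] at h4
  simpa [ENNReal.ofReal_pow, ofReal_norm] using h4

theorem hs_star (T : H →L[ℂ] H) : hs (star T) = hs T := by
  unfold hs
  simp_rw [parseval (H := H)]
  rw [ENNReal.tsum_comm]
  refine tsum_congr fun i => tsum_congr fun j => ?_
  rw [ContinuousLinearMap.star_eq_adjoint, ContinuousLinearMap.adjoint_inner_right,
    ← inner_conj_symm, ← ofReal_norm, RCLike.norm_conj, ofReal_norm]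

theorem hs_mul_left_le {X : H →L[ℂ] H} (hX : ‖X‖ ≤ 1) (T : H →L[ℂ] H) : hs (X * T) ≤ hs T := by
  refine ENNReal.tsum_le_tsum fun i => ?_
  gcongr
  rw [mul_apply_eq_comp, enorm_le_iff_norm_le]
  calc ‖X (T (onb H i))‖ ≤ ‖X‖ * ‖T (onb H i)‖ := X.le_opNorm _
    _ ≤ 1 * ‖T (onb H i)‖ := by gcongr
    _ = _ := one_mul _

theorem hs_mul_right_le {X : H →L[ℂ] H} (hX : ‖X‖ ≤ 1) (T : H →L[ℂ] H) : hs (T * X) ≤ hs T := by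
  rw [← hs_star, star_mul, ← hs_star T]
  exact hs_mul_left_le (by simpa using hX) _

theorem exists_contraction (T : H →L[ℂ] H) {ε : ℝ} (hε : 0 < ε) :
    ∃ W : H →L[ℂ] H, ‖W‖ ≤ 1 ∧ ‖W * CFC.abs T - T‖ ≤ ε ∧ ‖star W * T - CFC.abs T‖ ≤ ε := by
  set P := CFC.abs T with hP
  have hP0 : 0 ≤ P := CFC.abs_nonneg T
  have hPsa : IsSelfAdjoint P := hP0.isSelfAdjoint
  have hspec : ∀ t ∈ spectrum ℝ P, 0 ≤ t := fun t ht => spectrum_nonneg_of_nonneg hP0 ht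
  have hc : ContinuousOn (fun t : ℝ => (t + ε)⁻¹) (spectrum ℝ P) :=
    ContinuousOn.inv₀ (by fun_prop) fun t ht => by have := hspec t ht; positivity
  set G := cfc (fun t : ℝ => (t + ε)⁻¹) P with hG
  have hGsa : star G = G := (cfc_predicate (R := ℝ) _ P : IsSelfAdjoint G)
  have hPid : cfc (fun t : ℝ => t) P = P := cfc_id' ℝ P
  have hGP : G * P = cfc (fun t : ℝ => (t + ε)⁻¹ * t) P := by
    rw [cfc_mul _ _ P hc (by fun_prop), hPid]
  have hPG : P * G = G * P := by
    have h : P * G = cfc (fun t : ℝ => t * (t + ε)⁻¹) P := by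
      rw [cfc_mul _ _ P (by fun_prop) hc, hPid]
    rw [h, hGP]
    simp_rw [mul_comm]
  have hGPn : ‖G * P‖ ≤ 1 := by
    rw [hGP]
    refine norm_cfc_le zero_le_one fun t ht => ?_
    have := hspec t ht
    rw [Real.norm_of_nonneg (by positivity), inv_mul_le_one₀ (by positivity)]
    linarith
  have hGε : G * P + ε • G = 1 := by
    rw [hGP, hG, ← cfc_smul ε _ P hc,
      ← cfc_add P (fun t : ℝ => (t + ε)⁻¹ * t) (fun t : ℝ => ε • (t + ε)⁻¹)
        (hc.mul (by fun_prop)) (hc.const_smul ε),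
      ← cfc_one ℝ P]
    refine cfc_congr fun t ht => ?_
    have := hspec t ht
    have h2 : t + ε ≠ 0 := by positivity
    simp only [smul_eq_mul, Pi.one_apply]
    field_simp
  have hsq : P * P = star T * T := CFC.abs_mul_abs T
  have hW : ‖T * G‖ ≤ 1 := by
    have h1 : star (T * G) * (T * G) = star (G * P) * (G * P) := by
      rw [star_mul, star_mul, hGsa, hPsa.star_eq]
      calc G * star T * (T * G) = G * (star T * T) * G := by noncomm_ring
        _ = G * P * (P * G) := by rw [← hsq]; noncomm_ring
        _ = P * G * (G * P) := by rw [hPG]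
    have h2 : ‖T * G‖ * ‖T * G‖ = ‖G * P‖ * ‖G * P‖ := by
      rw [← CStarRing.norm_star_mul_self, ← CStarRing.norm_star_mul_self, h1]
    nlinarith [norm_nonneg (T * G), norm_nonneg (G * P)]
  refine ⟨T * G, hW, ?_, ?_⟩
  · have : T * G * P - T = -(ε • (T * G)) := by
      have h3 : T * (G * P + ε • G) = T := by rw [hGε, mul_one]
      rw [mul_add, mul_smul_comm, ← mul_assoc] at h3
      nth_rewrite 2 [← h3]
      abel
    rw [this, norm_neg, norm_smul, Real.norm_of_nonneg hε.le]
    nlinarith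
  · have : star (T * G) * T - P = -(ε • (G * P)) := by
      have h3 : (G * P + ε • G) * P = P := by rw [hGε, one_mul]
      rw [add_mul, smul_mul_assoc, mul_assoc, hsq] at h3
      rw [star_mul, hGsa, mul_assoc, sub_eq_iff_eq_add]
      nth_rewrite 2 [← h3]
      abel
    rw [this, norm_neg, norm_smul, Real.norm_of_nonneg hε.le]
    nlinarith

theorem inner_abs (T : H →L[ℂ] H) (x y : H) :
    ⟪x, CFC.abs T y⟫_ℂ = ⟪CFC.sqrt (CFC.abs T) x, CFC.sqrt (CFC.abs T) y⟫_ℂ := by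
  have h : CFC.sqrt (CFC.abs T) * CFC.sqrt (CFC.abs T) = CFC.abs T :=
    CFC.sqrt_mul_sqrt_self _ (CFC.abs_nonneg T)
  have hs : star (CFC.sqrt (CFC.abs T)) = CFC.sqrt (CFC.abs T) :=
    (CFC.sqrt_nonneg (CFC.abs T)).isSelfAdjoint
  conv_lhs => rw [← h, mul_apply_eq_comp, ← ContinuousLinearMap.adjoint_inner_left,
    ← ContinuousLinearMap.star_eq_adjoint, hs]

theorem re_inner_abs (T : H →L[ℂ] H) (x : H) :
    (⟪x, CFC.abs T x⟫_ℂ).re = ‖CFC.sqrt (CFC.abs T) x‖ ^ 2 := by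
  rw [inner_abs, inner_self_eq_norm_sq_to_K]; norm_cast

theorem isTraceClass_iff_hs (T : H →L[ℂ] H) :
    IsTraceClass T ↔ hs (CFC.sqrt (CFC.abs T)) ≠ ∞ := by
  unfold IsTraceClass hs
  simp_rw [re_inner_abs]
  have e : ∀ i, ‖CFC.sqrt (CFC.abs T) (onb H i)‖ₑ ^ 2 =
      ((‖CFC.sqrt (CFC.abs T) (onb H i)‖₊ ^ 2 : NNReal) : ℝ≥0∞) := fun i => by
    rw [ENNReal.coe_pow]; rfl
  simp_rw [e, ENNReal.tsum_coe_ne_top_iff_summable, ← NNReal.summable_coe]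
  simp

/-- Trace class operators are those `T` for which the sums `∑ᵢ |⟨X eᵢ, T eᵢ⟩|`, `X` a contraction,
are bounded. -/
theorem isTraceClass_iff_bounded (T : H →L[ℂ] H) :
    IsTraceClass T ↔ ∃ C : ℝ, ∀ X : H →L[ℂ] H, ‖X‖ ≤ 1 → ∀ s : Finset (basisIndex H),
      ∑ i ∈ s, ‖⟪X (onb H i), T (onb H i)⟫_ℂ‖ ≤ C := by
  constructor
  · intro hT
    rw [isTraceClass_iff_hs] at hT
    set S := CFC.sqrt (CFC.abs T) with hS
    have hsum : ∀ Y : H →L[ℂ] H, hs Y ≤ hs S → ∀ s : Finset (basisIndex H),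
        ∑ i ∈ s, ‖Y (onb H i)‖ ^ 2 ≤ (hs S).toReal := by
      intro Y hY s
      have h1 : ∑ i ∈ s, ‖Y (onb H i)‖ₑ ^ 2 ≤ hs S := (ENNReal.sum_le_tsum s).trans hY
      have h2 := ENNReal.toReal_mono hT h1
      rw [ENNReal.toReal_sum (fun i _ => by simp)] at h2
      simpa using h2
    refine ⟨(hs S).toReal, fun X hX s => ?_⟩
    refine le_of_forall_pos_le_add fun δ hδ => ?_
    have hδ' : 0 < δ / (s.card + 1) := by positivity
    obtain ⟨W, hW, hWT, -⟩ := exists_contraction T hδ'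
    have hnorm : ∀ i, ‖onb H i‖ = 1 := fun i => (onb H).orthonormal.1 i
    have hWX : ‖star W * X‖ ≤ 1 := (norm_mul_le _ _).trans (by
      rw [norm_star]; exact mul_le_one₀ hW (norm_nonneg _) hX)
    have hterm : ∀ i, ‖⟪X (onb H i), T (onb H i)⟫_ℂ‖ ≤
        (‖(S * (star W * X)) (onb H i)‖ ^ 2 + ‖S (onb H i)‖ ^ 2) / 2 + δ / (s.card + 1) := by
      intro i
      have e1 : ⟪X (onb H i), T (onb H i)⟫_ℂ =
          ⟪(S * (star W * X)) (onb H i), S (onb H i)⟫_ℂ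
            - ⟪X (onb H i), (W * CFC.abs T - T) (onb H i)⟫_ℂ := by
        have e2 : ⟪(S * (star W * X)) (onb H i), S (onb H i)⟫_ℂ =
            ⟪X (onb H i), (W * CFC.abs T) (onb H i)⟫_ℂ := by
          rw [mul_apply_eq_comp, mul_apply_eq_comp W, hS, ← inner_abs,
            mul_apply_eq_comp, ContinuousLinearMap.star_eq_adjoint,
            ContinuousLinearMap.adjoint_inner_left]
        rw [e2, sub_apply, inner_sub_right]
        ring
      rw [e1]
      refine (norm_sub_le _ _).trans (add_le_add ?_ ?_)
      · refine (norm_inner_le_norm _ _).trans ?_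
        nlinarith [sq_nonneg (‖(S * (star W * X)) (onb H i)‖ - ‖S (onb H i)‖)]
      · refine (norm_inner_le_norm _ _).trans ?_
        calc _ ≤ (‖X‖ * ‖onb H i‖) * (‖W * CFC.abs T - T‖ * ‖onb H i‖) := by
              gcongr <;> exact ContinuousLinearMap.le_opNorm _ _
          _ = ‖X‖ * ‖W * CFC.abs T - T‖ := by rw [hnorm]; ring
          _ ≤ 1 * (δ / (s.card + 1)) := by gcongr
          _ = _ := one_mul _
    refine (Finset.sum_le_sum fun i _ => hterm i).trans ?_
    rw [Finset.sum_add_distrib, ← Finset.sum_div, Finset.sum_add_distrib, Finset.sum_const,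
      nsmul_eq_mul]
    have h1 := hsum _ (hs_mul_right_le hWX S) s
    have h2 := hsum S le_rfl s
    have h3 : (s.card : ℝ) * (δ / (s.card + 1)) ≤ δ := by
      rw [mul_div_assoc', div_le_iff₀ (by positivity)]
      nlinarith
    linarith
  · rintro ⟨C, hC⟩
    refine summable_of_sum_le (c := C) (fun i => by rw [re_inner_abs]; positivity) fun s => ?_
    refine le_of_forall_pos_le_add fun δ hδ => ?_
    have hδ' : 0 < δ / (s.card + 1) := by positivity
    obtain ⟨W, hW, -, hWT⟩ := exists_contraction T hδ'
    have hnorm : ∀ i, ‖onb H i‖ = 1 := fun i => (onb H).orthonormal.1 i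
    have hterm : ∀ i, (⟪onb H i, CFC.abs T (onb H i)⟫_ℂ).re ≤
        ‖⟪W (onb H i), T (onb H i)⟫_ℂ‖ + δ / (s.card + 1) := by
      intro i
      have e1 : ⟪onb H i, CFC.abs T (onb H i)⟫_ℂ = ⟪W (onb H i), T (onb H i)⟫_ℂ
          - ⟪onb H i, (star W * T - CFC.abs T) (onb H i)⟫_ℂ := by
        rw [sub_apply, inner_sub_right, mul_apply_eq_comp,
          ContinuousLinearMap.star_eq_adjoint, ContinuousLinearMap.adjoint_inner_right]
        ring
      rw [e1]
      refine (Complex.re_le_norm _).trans ((norm_sub_le _ _).trans (add_le_add le_rfl ?_))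
      refine (norm_inner_le_norm _ _).trans ?_
      rw [hnorm, one_mul]
      refine (ContinuousLinearMap.le_opNorm _ _).trans ?_
      rw [hnorm, mul_one]
      exact hWT
    refine (Finset.sum_le_sum fun i _ => hterm i).trans ?_
    rw [Finset.sum_add_distrib, Finset.sum_const, nsmul_eq_mul]
    have h3 : (s.card : ℝ) * (δ / (s.card + 1)) ≤ δ := by
      rw [mul_div_assoc', div_le_iff₀ (by positivity)]
      nlinarith
    linarith [hC W hW s]

variable (H) in
/-- The trace class `𝒯¹(H)`, as a linear subspace of the bounded operators on `H`. -/
def traceClass : Submodule ℂ (H →L[ℂ] H) where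
  carrier := {T | IsTraceClass T}
  zero_mem' := by
    change IsTraceClass _
    rw [isTraceClass_iff_bounded]
    exact ⟨0, fun X _ s => by simp⟩
  add_mem' := by
    intro A B hA hB
    change IsTraceClass _
    replace hA : IsTraceClass A := hA
    replace hB : IsTraceClass B := hB
    rw [isTraceClass_iff_bounded] at *
    obtain ⟨C, hC⟩ := hA
    obtain ⟨D, hD⟩ := hB
    refine ⟨C + D, fun X hX s => ?_⟩
    refine le_trans ?_ (add_le_add (hC X hX s) (hD X hX s))
    rw [← Finset.sum_add_distrib]
    refine Finset.sum_le_sum fun i _ => ?_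
    rw [add_apply, inner_add_right]
    exact norm_add_le _ _
  smul_mem' := by
    intro c A hA
    change IsTraceClass _
    replace hA : IsTraceClass A := hA
    rw [isTraceClass_iff_bounded] at *
    obtain ⟨C, hC⟩ := hA
    refine ⟨‖c‖ * C, fun X hX s => ?_⟩
    refine le_trans (le_of_eq ?_) (mul_le_mul_of_nonneg_left (hC X hX s) (norm_nonneg c))
    rw [Finset.mul_sum]
    refine Finset.sum_congr rfl fun i _ => ?_
    rw [smul_apply, inner_smul_right, norm_mul]

end TraceClass

section PhaseSpace

variable {Ξ : Type*} [AddCommGroup Ξ] [TopologicalSpace Ξ]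

/-- A separately continuous, normalized multiplier (2-cocycle) `m : Ξ × Ξ → S¹` is a Heisenberg
multiplier if `x ↦ σ(x, ·)`, with `σ(x, y) = m(x, y) / m(y, x)`, is a topological isomorphism of
`Ξ` onto its Pontryagin dual. -/
structure IsHeisenbergMultiplier (m : Ξ → Ξ → Circle) : Prop where
  cocycle : ∀ x y z, m (x + y) z * m x y = m x (y + z) * m y z
  right_zero : ∀ x, m x 0 = 1
  left_zero : ∀ x, m 0 x = 1
  continuous_left : ∀ y, Continuous fun x => m x y
  continuous_right : ∀ x, Continuous fun y => m x y
  duality : ∃ e : Multiplicative Ξ ≃ₜ* PontryaginDual (Multiplicative Ξ),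
    ∀ x y : Ξ, e (Multiplicative.ofAdd x) (Multiplicative.ofAdd y) = m x y / m y x

variable {H : Type*} [NormedAddCommGroup H] [InnerProductSpace ℂ H] [CompleteSpace H]

/-- `U` is an irreducible, strongly continuous projective unitary representation of `Ξ` on `H`
with multiplier `m`. -/
structure IsIrreducibleProjRep (m : Ξ → Ξ → Circle) (U : Ξ → unitary (H →L[ℂ] H)) : Prop where
  mul : ∀ x y, (U x : H →L[ℂ] H) * U y = (m x y : ℂ) • (U (x + y) : H →L[ℂ] H)
  continuous : ∀ φ : H, Continuous fun x => (U x : H →L[ℂ] H) φ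
  nontrivial : Nontrivial H
  irreducible : ∀ K : Submodule ℂ H, IsClosed (K : Set H) →
    (∀ x, ∀ φ ∈ K, (U x : H →L[ℂ] H) φ ∈ K) → K = ⊥ ∨ K = ⊤

/-- Square integrability: some matrix coefficient `x ↦ ⟨U_x φ, ψ⟩` (linear in `φ`) with nonzero
`φ, ψ` is in `L²`. -/
def IsSquareIntegrable [MeasurableSpace Ξ] (μ : Measure Ξ) (U : Ξ → unitary (H →L[ℂ] H)) : Prop :=
  ∃ φ ψ : H, φ ≠ 0 ∧ ψ ≠ 0 ∧ MemLp (fun x => ⟪ψ, (U x : H →L[ℂ] H) φ⟫_ℂ) 2 μ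

/-- The unitary `R` implements the reflection `x ↦ -x`: `U_x R = R U_{-x}`. -/
def IsReflection (U : Ξ → unitary (H →L[ℂ] H)) (R : unitary (H →L[ℂ] H)) : Prop :=
  ∀ x, U x * R = R * U (-x)

/-- The shift `α_x(A) = U_x A U_x*` of an operator. -/
def shift (U : Ξ → unitary (H →L[ℂ] H)) (x : Ξ) (A : H →L[ℂ] H) : H →L[ℂ] H :=
  (U x : H →L[ℂ] H) * A * star (U x : H →L[ℂ] H)

/-- The reflection `β₋(A) = R A R*` of an operator. -/
def reflect (R : unitary (H →L[ℂ] H)) (A : H →L[ℂ] H) : H →L[ℂ] H :=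
  (R : H →L[ℂ] H) * A * star (R : H →L[ℂ] H)

/-- Operator-operator convolution as a function on `Ξ`: `(A ∗ B)(x) = tr(A α_x(β₋(B)))`. -/
def opConvFun (U : Ξ → unitary (H →L[ℂ] H)) (R : unitary (H →L[ℂ] H)) (A B : H →L[ℂ] H) : Ξ → ℂ :=
  fun x => trace (A * shift U x (reflect R B))

variable [MeasurableSpace Ξ]

/-- Function-operator convolution `f ∗ A = ∫ f(x) α_x(A) dx`, as a Bochner integral of bounded
operators. (For `A` of trace class the integral converges even in trace norm; the value is the
same, as the trace norm dominates the operator norm.) -/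
def funOpConv (μ : Measure Ξ) (U : Ξ → unitary (H →L[ℂ] H)) (f : Ξ → ℂ) (A : H →L[ℂ] H) :
    H →L[ℂ] H :=
  ∫ x, f x • shift U x A ∂μ

/-- The class in `L¹` of a function (with value `0` for a function that is not integrable). -/
def toL1 (μ : Measure Ξ) (f : Ξ → ℂ) : Lp ℂ 1 μ :=
  open Classical in if h : Integrable f μ then h.toL1 f else 0

/-- A bounded operator as an element of the trace class (with value `0` for an operator that is
not of trace class). -/
def toTraceClass (T : H →L[ℂ] H) : traceClass H :=
  open Classical in if h : IsTraceClass T then ⟨T, h⟩ else 0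

/-- The convolution `(f, A) ∗ (g, B) = (f ∗ g + A ∗ B, f ∗ B + g ∗ A)` on `L¹(Ξ) ⊕ 𝒯¹(H)`. -/
def conv (μ : Measure Ξ) (U : Ξ → unitary (H →L[ℂ] H)) (R : unitary (H →L[ℂ] H))
    (p q : Lp ℂ 1 μ × traceClass H) : Lp ℂ 1 μ × traceClass H :=
  (toL1 μ (p.1 ⋆[ContinuousLinearMap.mul ℂ ℂ, μ] q.1) + toL1 μ (opConvFun U R p.2 q.2),
    toTraceClass (funOpConv μ U p.1 q.2) + toTraceClass (funOpConv μ U q.1 p.2))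

end PhaseSpace

end QHA

end

noncomputable section

set_option linter.unusedSectionVars false

namespace QHA

/-! ### Trace class operators as sums of rank one operators -/

section Nuclear

variable {H : Type*} [NormedAddCommGroup H] [InnerProductSpace ℂ H]

/-! The algebra laws are read off on the Fourier side. To `f` attach its symplectic Fourier
transform `f̂(y) = ∫ f(x) σ(y, x) dx`, and to `A` its Fourier-Weyl transform `Â(y) = tr(A U_y)`. The
convolutions become pointwise products: `f̂ ĝ` for `f ∗ g`, `f̂ Â` for `f ∗ A`, and `κ Â B̂` for `A
∗ B`, where `κ(y)` is a real constant `k` times a phase depending only on `y` and `m`. So at each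
`y` the product is that of `ℂ[t]/(t² - κ(y))`, and every identity is a ring identity, once the pair
of transforms is known to be injective.

The rule for `A ∗ B` rests on the orthogonality relations `∫ ⟨a, U_x φ⟩ ⟨U_x ψ, b⟩ dx = k ⟨a, b⟩ ⟨ψ,
φ⟩` (`exists_orthogonality`): multiplying a matrix coefficient by the character `σ(y, ·)` amounts to
moving both vectors by `U_y*`. Trace class operators are summed from rank one operators
(`exists_nuclearExpansion`). The rule for `f ∗ A` is deduced from the other two by convolving with a
rank one operator.

Injectivity on `L¹` is `ae_eq_zero_of_integral_mul_char_eq_zero`: of the Heisenberg duality it needs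
only that the characters `σ(y, ·)` form a group and separate points. For an operator, `Â = 0` forces
`A ∗ B = 0` for all rank one `B`, and the values at `0` of these continuous functions are all the
matrix elements of `A`.

The reflection `R` comes from Schur's lemma: by the symmetry of `m`, the representations `U_x` and
`U_{-x}` have the same multiplier, so averaging a rank one operator intertwines them, and Fourier
uniqueness shows that some average is nonzero.

Neither `Ξ` is assumed σ-compact nor `H` separable. Exchanges of integrals are therefore done for
compactly supported continuous functions and carried over by absolutely convergent series. -/

theorem norm_mul_le_sq_add_sq (z w : ℂ) : ‖z * w‖ ≤ ‖z‖ ^ 2 + ‖w‖ ^ 2 := by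
  rw [norm_mul]
  nlinarith [sq_nonneg (‖z‖ - ‖w‖), norm_nonneg z, norm_nonneg w, sq_nonneg ‖z‖, sq_nonneg ‖w‖]

theorem summable_mul_of_sq {ι : Type*} {u v : ι → ℂ} (hu : Summable fun i => ‖u i‖ ^ 2)
    (hv : Summable fun i => ‖v i‖ ^ 2) : Summable fun i => u i * v i :=
  Summable.of_norm_bounded (hu.add hv) fun _ => norm_mul_le_sq_add_sq _ _

theorem summable_norm_sq_inner_of_sq {ι : Type*} {a : ι → H} (ha : Summable fun i => ‖a i‖ ^ 2)
    (x : H) : Summable fun i => ‖⟪x, a i⟫_ℂ‖ ^ 2 := by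
  refine Summable.of_nonneg_of_le (fun i => sq_nonneg _) (fun _ => ?_) (ha.mul_left (‖x‖ ^ 2))
  rw [← mul_pow]
  gcongr
  exact norm_inner_le_norm _ _

theorem summable_norm_sq_inner_of_sq' {ι : Type*} {a : ι → H} (ha : Summable fun i => ‖a i‖ ^ 2)
    (x : H) : Summable fun i => ‖⟪a i, x⟫_ℂ‖ ^ 2 := by
  simp_rw [norm_inner_symm _ x]
  exact summable_norm_sq_inner_of_sq ha x

theorem summable_norm_sq_apply {ι : Type*} {a : ι → H} (ha : Summable fun i => ‖a i‖ ^ 2)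
    (C : H →L[ℂ] H) : Summable fun i => ‖C (a i)‖ ^ 2 := by
  refine Summable.of_nonneg_of_le (fun i => sq_nonneg _) (fun _ => ?_) (ha.mul_left (‖C‖ ^ 2))
  rw [← mul_pow]
  gcongr
  exact C.le_opNorm _

/-- `A = ∑ₙ |bₙ⟩⟨aₙ|` with square summable `‖aₙ‖` and `‖bₙ‖`. -/
structure NuclearExpansion (A : H →L[ℂ] H) (a b : ℕ → H) : Prop where
  left : Summable fun n => ‖a n‖ ^ 2
  right : Summable fun n => ‖b n‖ ^ 2
  hasSum : ∀ x y, HasSum (fun n => ⟪x, b n⟫_ℂ * ⟪a n, y⟫_ℂ) ⟪x, A y⟫_ℂ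

theorem nuclearExpansion_rankOne (c d : H) :
    NuclearExpansion (InnerProductSpace.rankOne ℂ d c)
      (fun n => if n = 0 then c else 0) (fun n => if n = 0 then d else 0) where
  left := summable_of_ne_finset_zero (s := {0}) fun n hn => by
    simp only [Finset.mem_singleton] at hn; simp [hn]
  right := summable_of_ne_finset_zero (s := {0}) fun n hn => by
    simp only [Finset.mem_singleton] at hn; simp [hn]
  hasSum x y := by
    convert hasSum_single 0 fun n hn => ?_ using 1
    · simp [mul_comm]
    · simp [hn]

variable [CompleteSpace H]

theorem norm_apply_abs (T : H →L[ℂ] H) (x : H) : ‖CFC.abs T x‖ = ‖T x‖ := by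
  have h : ∀ S : H →L[ℂ] H, ((‖S x‖ ^ 2 : ℝ) : ℂ) = ⟪x, (star S * S) x⟫_ℂ := fun S => by
    rw [mul_apply_eq_comp, ContinuousLinearMap.star_eq_adjoint,
      ContinuousLinearMap.adjoint_inner_right, inner_self_eq_norm_sq_to_K]
    norm_cast
  have h2 : ‖CFC.abs T x‖ ^ 2 = ‖T x‖ ^ 2 := by
    have h3 := h (CFC.abs T)
    rw [(CFC.abs_nonneg T).isSelfAdjoint.star_eq, CFC.abs_mul_abs, ← h T] at h3
    exact_mod_cast h3
  exact (sq_eq_sq₀ (norm_nonneg _) (norm_nonneg _)).1 h2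

/-- Polar decomposition, with a contraction in place of a partial isometry. -/
theorem exists_contraction_mul_abs (T : H →L[ℂ] H) :
    ∃ V : H →L[ℂ] H, ‖V‖ ≤ 1 ∧ V * CFC.abs T = T := by
  set P := CFC.abs T with hP
  let r : Submodule ℂ H := LinearMap.range (P : H →ₗ[ℂ] H)
  -- `g` is a linear section of `P = |T|` over its range. Since `‖Px‖ = ‖Tx‖`, the map `T ∘ g` is
  -- isometric on the range; it is extended to the closure by continuity and by zero on the
  -- orthogonal complement.
  obtain ⟨g, hg⟩ := (P : H →ₗ[ℂ] H).rangeRestrict.exists_rightInverse_of_surjective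
    (LinearMap.range_rangeRestrict _)
  have hg' : ∀ z : r, P (g z) = z := fun z => congrArg Subtype.val (LinearMap.congr_fun hg z)
  let u : r →ₗ[ℂ] H := (T : H →ₗ[ℂ] H) ∘ₗ g
  have hu : ∀ z, ‖u z‖ = ‖z‖ := fun z => by
    change ‖T (g z)‖ = _
    rw [← norm_apply_abs, ← hP, hg']; rfl
  let u' : r →L[ℂ] H := u.mkContinuous 1 fun z => by rw [hu, one_mul]
  let K := r.topologicalClosure
  let e : r →L[ℂ] K := ⟨Submodule.inclusion r.le_topologicalClosure,
    (continuous_subtype_val).subtype_mk _⟩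
  have he : ∀ z, ‖e z‖ = ‖z‖ := fun z => rfl
  have hei : IsUniformInducing e :=
    (AddMonoidHomClass.isometry_of_norm e he).isUniformInducing
  have hed : DenseRange e := by
    intro z
    rw [mem_closure_iff_nhds]
    have hz : (z : H) ∈ closure (r : Set H) := z.2
    intro t ht
    rw [nhds_subtype_eq_comap] at ht
    obtain ⟨s, hs, hst⟩ := ht
    obtain ⟨w, hws, hwr⟩ := mem_closure_iff_nhds.1 hz s hs
    exact ⟨e ⟨w, hwr⟩, hst hws, ⟨_, rfl⟩⟩
  let V0 : K →L[ℂ] H := u'.extend e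
  have hV0 : ∀ z, V0 (e z) = u z := fun z => ContinuousLinearMap.extend_eq _ hed hei z
  have hV0n : ‖V0‖ ≤ 1 := by
    refine V0.opNorm_le_bound zero_le_one fun z => ?_
    rw [one_mul]
    refine hed.induction_on (p := fun z => ‖V0 z‖ ≤ ‖z‖) z
      (isClosed_le (by fun_prop) (by fun_prop)) fun w => ?_
    rw [hV0, he, hu]
  have : CompleteSpace K := r.isClosed_topologicalClosure.completeSpace_coe
  refine ⟨V0 ∘L K.orthogonalProjectionOnto, ?_, ?_⟩
  · refine (ContinuousLinearMap.opNorm_comp_le _ _).trans ?_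
    exact mul_le_one₀ hV0n (norm_nonneg _) K.orthogonalProjectionOnto_norm_le
  · ext x
    have hx : P x ∈ r := ⟨x, rfl⟩
    have h1 : K.orthogonalProjectionOnto (P x) = e ⟨P x, hx⟩ :=
      K.orthogonalProjectionOnto_mem_subspace_eq_self (e ⟨P x, hx⟩)
    change V0 (K.orthogonalProjectionOnto (P x)) = T x
    rw [h1, hV0]
    change T (g _) = T x
    rw [← sub_eq_zero, ← map_sub, ← norm_eq_zero, ← norm_apply_abs, ← hP, map_sub, hg', sub_self,
      norm_zero]

theorem hasSum_norm_inner_onb_sq (x : H) :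
    HasSum (fun i => ‖⟪onb H i, x⟫_ℂ‖ ^ 2) (‖x‖ ^ 2) := by
  have h3 := Complex.hasSum_re ((onb H).hasSum_inner_mul_inner x x)
  have e1 : (⟪x, x⟫_ℂ).re = ‖x‖ ^ 2 := by
    rw [inner_self_eq_norm_sq_to_K]; norm_cast
  rw [e1] at h3
  convert h3 using 2 with i
  rw [← inner_conj_symm x, ← Complex.normSq_eq_conj_mul_self, Complex.ofReal_re,
    Complex.normSq_eq_norm_sq]

namespace NuclearExpansion

variable {A : H →L[ℂ] H} {a b : ℕ → H}

/-- Bound each product by a sum of squares and apply Bessel's inequality to `X* bₙ` and to `aₙ`. The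
bound depends only on the norms of `aₙ` and `bₙ`, so it is the same for all unitary conjugates of
`A`. -/
theorem sum_norm_inner_le (h : NuclearExpansion A a b) {X : H →L[ℂ] H} (hX : ‖X‖ ≤ 1)
    (s : Finset (basisIndex H)) :
    ∑ i ∈ s, ‖⟪X (onb H i), A (onb H i)⟫_ℂ‖ ≤ ∑' n, (‖b n‖ ^ 2 + ‖a n‖ ^ 2) := by
  have hs : ∀ i, Summable fun n =>
      ‖⟪X (onb H i), b n⟫_ℂ‖ ^ 2 + ‖⟪a n, onb H i⟫_ℂ‖ ^ 2 := fun i =>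
    (summable_norm_sq_inner_of_sq h.right _).add (summable_norm_sq_inner_of_sq' h.left _)
  calc ∑ i ∈ s, ‖⟪X (onb H i), A (onb H i)⟫_ℂ‖
      ≤ ∑ i ∈ s, ∑' n, (‖⟪X (onb H i), b n⟫_ℂ‖ ^ 2 + ‖⟪a n, onb H i⟫_ℂ‖ ^ 2) := by
        refine Finset.sum_le_sum fun i _ => ?_
        rw [← (h.hasSum _ _).tsum_eq]
        exact tsum_of_norm_bounded (hs i).hasSum fun n => norm_mul_le_sq_add_sq _ _
    _ = ∑' n, ∑ i ∈ s, (‖⟪X (onb H i), b n⟫_ℂ‖ ^ 2 + ‖⟪a n, onb H i⟫_ℂ‖ ^ 2) :=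
        (Summable.tsum_finsetSum fun i _ => hs i).symm
    _ ≤ ∑' n, (‖b n‖ ^ 2 + ‖a n‖ ^ 2) := by
        refine Summable.tsum_le_tsum (fun n => ?_) (summable_sum fun i _ => hs i)
          (h.right.add h.left)
        rw [Finset.sum_add_distrib]
        refine add_le_add ?_ ?_
        · simp_rw [← ContinuousLinearMap.adjoint_inner_right X]
          refine ((onb H).orthonormal.sum_inner_products_le _).trans ?_
          gcongr
          refine (ContinuousLinearMap.le_opNorm _ _).trans ?_
          rw [LinearIsometryEquiv.norm_map]
          exact mul_le_of_le_one_left (norm_nonneg _) hX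
        · simp_rw [norm_inner_symm (a n)]
          exact (onb H).orthonormal.sum_inner_products_le _

theorem isTraceClass (h : NuclearExpansion A a b) : IsTraceClass A :=
  (isTraceClass_iff_bounded A).2 ⟨_, fun _ hX s => h.sum_norm_inner_le hX s⟩

/-- Both sides are iterated sums of `⟨aₙ, eᵢ⟩⟨eᵢ, bₙ⟩`, which is absolutely summable over pairs by
Parseval. -/
theorem hasSum_trace (h : NuclearExpansion A a b) :
    HasSum (fun n => ⟪a n, b n⟫_ℂ) (trace A) := by
  have hsq : ∀ c : ℕ → H, Summable (fun n => ‖c n‖ ^ 2) →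
      Summable fun p : ℕ × basisIndex H => ‖⟪onb H p.2, c p.1⟫_ℂ‖ ^ 2 := fun c hc => by
    rw [summable_prod_of_nonneg fun _ => sq_nonneg _]
    refine ⟨fun n => (hasSum_norm_inner_onb_sq (c n)).summable, ?_⟩
    simp_rw [(hasSum_norm_inner_onb_sq (c _)).tsum_eq]
    exact hc
  have hsum : Summable fun p : ℕ × basisIndex H => ⟪a p.1, onb H p.2⟫_ℂ * ⟪onb H p.2, b p.1⟫_ℂ := by
    refine summable_mul_of_sq ?_ (hsq b h.right)
    simp_rw [norm_inner_symm (a _)]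
    exact hsq a h.left
  have h1 : ∀ n, HasSum (fun i => ⟪a n, onb H i⟫_ℂ * ⟪onb H i, b n⟫_ℂ) ⟪a n, b n⟫_ℂ := fun n =>
    (onb H).hasSum_inner_mul_inner _ _
  have h2 := hsum.hasSum.prod_fiberwise h1
  have h3 : trace A = ∑' p : ℕ × basisIndex H, ⟪a p.1, onb H p.2⟫_ℂ * ⟪onb H p.2, b p.1⟫_ℂ := by
    rw [hsum.tsum_prod]
    refine Eq.trans ?_ (Summable.tsum_comm
      (f := fun n i => ⟪a n, onb H i⟫_ℂ * ⟪onb H i, b n⟫_ℂ) hsum)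
    refine tsum_congr fun i => ?_
    rw [← (h.hasSum _ _).tsum_eq]
    exact tsum_congr fun n => mul_comm _ _
  rw [h3]
  exact h2

theorem mul_right (h : NuclearExpansion A a b) (C : H →L[ℂ] H) :
    NuclearExpansion (A * C) (fun n => star C (a n)) b where
  left := summable_norm_sq_apply h.left _
  right := h.right
  hasSum x y := by
    simp_rw [ContinuousLinearMap.star_eq_adjoint, ContinuousLinearMap.adjoint_inner_left]
    exact h.hasSum x (C y)

theorem mul_left (h : NuclearExpansion A a b) (C : H →L[ℂ] H) :
    NuclearExpansion (C * A) a (fun n => C (b n)) where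
  left := h.left
  right := summable_norm_sq_apply h.right _
  hasSum x y := by
    rw [mul_apply_eq_comp, ← ContinuousLinearMap.adjoint_inner_left]
    simp_rw [← ContinuousLinearMap.adjoint_inner_left C]
    exact h.hasSum _ y

theorem hasSum_trace_mul (h : NuclearExpansion A a b) (C : H →L[ℂ] H) :
    HasSum (fun n => ⟪a n, C (b n)⟫_ℂ) (trace (A * C)) := by
  have h1 := (h.mul_right C).hasSum_trace
  simp_rw [ContinuousLinearMap.star_eq_adjoint, ContinuousLinearMap.adjoint_inner_left] at h1
  exact h1

end NuclearExpansion

/-- With `S = |T|^{1/2}` and `T = V|T|`, write `T = (VS)S` and insert the orthonormal basis between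
the factors: `bᵢ = VS eᵢ`, `aᵢ = S eᵢ`. -/
theorem IsTraceClass.exists_nuclearExpansion {T : H →L[ℂ] H} (hT : IsTraceClass T) :
    ∃ a b, NuclearExpansion T a b := by
  obtain ⟨V, hV, hVT⟩ := exists_contraction_mul_abs T
  set S := CFC.sqrt (CFC.abs T) with hS
  have hSS : S * S = CFC.abs T := CFC.sqrt_mul_sqrt_self _ (CFC.abs_nonneg T)
  have hSsa : star S = S := (CFC.sqrt_nonneg (CFC.abs T)).isSelfAdjoint
  set Y := V * S with hY
  have hYS : Y * S = T := by rw [hY, mul_assoc, hSS, hVT]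
  have hsumS : Summable fun i => ‖S (onb H i)‖ ^ 2 := by
    have h := hT
    unfold IsTraceClass at h
    simp_rw [re_inner_abs] at h
    exact h
  have hsumY : Summable fun i => ‖Y (onb H i)‖ ^ 2 := by
    have := summable_norm_sq_apply hsumS V
    exact this
  have hexp : ∀ x y, HasSum (fun i => ⟪x, Y (onb H i)⟫_ℂ * ⟪S (onb H i), y⟫_ℂ) ⟪x, T y⟫_ℂ := by
    intro x y
    have h := (onb H).hasSum_inner_mul_inner (star Y x) (star S y)
    simp_rw [ContinuousLinearMap.star_eq_adjoint, ContinuousLinearMap.adjoint_inner_left,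
      ContinuousLinearMap.adjoint_inner_right, ← ContinuousLinearMap.star_eq_adjoint, hSsa] at h
    rwa [← mul_apply_eq_comp Y, hYS] at h
  -- The basis may be uncountable, but only countably many `S eᵢ` are nonzero. These are indexed by
  -- natural numbers, with zero vectors in the unused places.
  set t : Set (basisIndex H) := Function.support fun i => ‖S (onb H i)‖ ^ 2 with ht
  have : Countable t := hsumS.countable_support.to_subtype
  obtain ⟨f, hf⟩ := exists_injective_nat t
  have hext : ∀ (φ : t → H) (n : ℕ), Function.extend f (fun i => ‖φ i‖ ^ 2) 0 n =
      ‖Function.extend f φ 0 n‖ ^ 2 := fun φ n => by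
    by_cases hn : ∃ i, f i = n
    · obtain ⟨i, rfl⟩ := hn
      simp [hf.extend_apply]
    · simp [Function.extend_apply' _ _ _ hn]
  refine ⟨Function.extend f (fun i : t => S (onb H i)) 0,
    Function.extend f (fun i : t => Y (onb H i)) 0, ?_, ?_, fun x y => ?_⟩
  · simp_rw [← hext]
    exact ((hasSum_extend_zero hf).2 (hsumS.comp_injective Subtype.val_injective).hasSum).summable
  · simp_rw [← hext]
    exact ((hasSum_extend_zero hf).2 (hsumY.comp_injective Subtype.val_injective).hasSum).summable
  · have h1 : HasSum (fun i : t => ⟪x, Y (onb H i)⟫_ℂ * ⟪S (onb H i), y⟫_ℂ) ⟪x, T y⟫_ℂ := by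
      refine (hasSum_subtype_iff_of_support_subset ?_).2 (hexp x y)
      intro i hi
      simp only [Function.mem_support, ne_eq, mul_eq_zero, not_or] at hi
      simp only [ht, Function.mem_support]
      intro h0
      apply hi.2
      rw [sq_eq_zero_iff, norm_eq_zero] at h0
      rw [h0, inner_zero_left]
    convert (hasSum_extend_zero hf).2 h1 using 1
    funext n
    by_cases hn : ∃ i, f i = n
    · obtain ⟨i, rfl⟩ := hn
      simp [hf.extend_apply]
    · simp [Function.extend_apply' _ _ _ hn]

theorem IsTraceClass.mul_right {T : H →L[ℂ] H} (hT : IsTraceClass T) (C : H →L[ℂ] H) :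
    IsTraceClass (T * C) := by
  obtain ⟨a, b, h⟩ := hT.exists_nuclearExpansion
  exact (h.mul_right C).isTraceClass

theorem IsTraceClass.summable_inner {T : H →L[ℂ] H} (hT : IsTraceClass T) :
    Summable fun i => ⟪onb H i, T (onb H i)⟫_ℂ := by
  obtain ⟨C, hC⟩ := (isTraceClass_iff_bounded T).1 hT
  refine Summable.of_norm (summable_of_sum_le (c := C) (fun i => norm_nonneg _) fun s => ?_)
  exact hC 1 ContinuousLinearMap.norm_id_le s

theorem trace_add {S T : H →L[ℂ] H} (hS : IsTraceClass S) (hT : IsTraceClass T) :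
    trace (S + T) = trace S + trace T := by
  unfold trace
  rw [← hS.summable_inner.tsum_add hT.summable_inner]
  simp_rw [add_apply, inner_add_right]

theorem trace_smul (c : ℂ) (T : H →L[ℂ] H) : trace (c • T) = c * trace T := by
  unfold trace
  rw [← tsum_mul_left]
  simp_rw [smul_apply, inner_smul_right]

theorem trace_mul_rankOne (T : H →L[ℂ] H) (c d : H) :
    trace (T * InnerProductSpace.rankOne ℂ d c) = ⟪c, T d⟫_ℂ := by
  have h := ((nuclearExpansion_rankOne c d).mul_left T).hasSum_trace
  refine h.unique ?_
  convert hasSum_single 0 fun n hn => ?_ using 1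
  · simp
  · simp [hn]

end Nuclear

/-! ### Projective representations and Schur's lemma -/

section Schur

variable {H : Type*} [NormedAddCommGroup H] [InnerProductSpace ℂ H] [CompleteSpace H]

theorem inner_unitary_unitary (u : unitary (H →L[ℂ] H)) (a b : H) :
    ⟪(u : H →L[ℂ] H) a, (u : H →L[ℂ] H) b⟫_ℂ = ⟪a, b⟫_ℂ := by
  rw [← ContinuousLinearMap.adjoint_inner_right, ← ContinuousLinearMap.star_eq_adjoint,
    ← mul_apply_eq_comp, Unitary.coe_star_mul_self]
  rfl

theorem norm_unitary_apply (u : unitary (H →L[ℂ] H)) (a : H) : ‖(u : H →L[ℂ] H) a‖ = ‖a‖ := by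
  rw [@norm_eq_sqrt_re_inner ℂ, @norm_eq_sqrt_re_inner ℂ _ _ _ _ a, inner_unitary_unitary]

theorem inner_star_unitary_apply (u : unitary (H →L[ℂ] H)) (a b : H) :
    ⟪star (u : H →L[ℂ] H) a, b⟫_ℂ = ⟪a, (u : H →L[ℂ] H) b⟫_ℂ := by
  rw [ContinuousLinearMap.star_eq_adjoint, ContinuousLinearMap.adjoint_inner_left]

theorem inner_star_unitary_apply_right (u : unitary (H →L[ℂ] H)) (a b : H) :
    ⟪a, star (u : H →L[ℂ] H) b⟫_ℂ = ⟪(u : H →L[ℂ] H) a, b⟫_ℂ := by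
  rw [ContinuousLinearMap.star_eq_adjoint, ContinuousLinearMap.adjoint_inner_right]

theorem unitary_apply_star_apply (u : unitary (H →L[ℂ] H)) (a : H) :
    (u : H →L[ℂ] H) (star (u : H →L[ℂ] H) a) = a := by
  rw [← mul_apply_eq_comp, ← Unitary.coe_star, Unitary.coe_mul_star_self]
  rfl

theorem star_apply_unitary_apply (u : unitary (H →L[ℂ] H)) (a : H) :
    star (u : H →L[ℂ] H) ((u : H →L[ℂ] H) a) = a := by
  rw [← mul_apply_eq_comp, Unitary.coe_star_mul_self]
  rfl

theorem inner_circle_smul_left (z : Circle) (a b : H) :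
    ⟪(z : ℂ) • a, b⟫_ℂ = ((z⁻¹ : Circle) : ℂ) * ⟪a, b⟫_ℂ := by
  rw [inner_smul_left, Circle.coe_inv_eq_conj]

namespace IsIrreducibleProjRep

variable {Ξ : Type*} [AddCommGroup Ξ] [TopologicalSpace Ξ] {m : Ξ → Ξ → Circle}
  {U : Ξ → unitary (H →L[ℂ] H)}

theorem mul_apply (hU : IsIrreducibleProjRep m U) (x y : Ξ) (φ : H) :
    (U x : H →L[ℂ] H) ((U y : H →L[ℂ] H) φ) = (m x y : ℂ) • (U (x + y) : H →L[ℂ] H) φ := by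
  rw [← mul_apply_eq_comp, hU.mul, smul_apply]

theorem zero_eq (hU : IsIrreducibleProjRep m U) :
    (U 0 : H →L[ℂ] H) = (m 0 0 : ℂ) • (1 : H →L[ℂ] H) := by
  have h := hU.mul 0 0
  rw [add_zero] at h
  have h2 := congrArg (fun T => star (U 0 : H →L[ℂ] H) * T) h
  simpa only [mul_smul_comm, ← mul_assoc, Unitary.coe_star_mul_self, one_mul] using h2

theorem apply_neg_apply (hU : IsIrreducibleProjRep m U) (x : Ξ) (φ : H) :
    (U x : H →L[ℂ] H) ((U (-x) : H →L[ℂ] H) φ) = ((m x (-x) * m 0 0 : Circle) : ℂ) • φ := by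
  rw [hU.mul_apply, add_neg_cancel, hU.zero_eq, smul_apply, smul_smul, Circle.coe_mul]
  rfl

theorem apply_eq_smul_apply_sub (hU : IsIrreducibleProjRep m U) (x y : Ξ) (φ : H) :
    (U x : H →L[ℂ] H) φ =
      (((m y (x - y))⁻¹ : Circle) : ℂ) • (U y : H →L[ℂ] H) ((U (x - y) : H →L[ℂ] H) φ) := by
  rw [hU.mul_apply, smul_smul, ← Circle.coe_mul, inv_mul_cancel, Circle.coe_one, one_smul,
    add_sub_cancel]

theorem star_mul_eq_smul (hU : IsIrreducibleProjRep m U) (x y : Ξ) (φ : H) :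
    star (U y : H →L[ℂ] H) ((U x : H →L[ℂ] H) φ) =
      (((m y (x - y))⁻¹ : Circle) : ℂ) • (U (x - y) : H →L[ℂ] H) φ := by
  rw [hU.apply_eq_smul_apply_sub x y, map_smul, star_apply_unitary_apply]

theorem apply_comm (hU : IsIrreducibleProjRep m U) (x y : Ξ) (φ : H) :
    (U x : H →L[ℂ] H) ((U y : H →L[ℂ] H) φ) =
      ((m x y / m y x : Circle) : ℂ) • (U y : H →L[ℂ] H) ((U x : H →L[ℂ] H) φ) := by
  rw [hU.mul_apply, hU.mul_apply, smul_smul, ← Circle.coe_mul, div_mul_cancel, add_comm]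

/-- Schur's lemma for self-adjoint operators. -/
theorem eq_smul_one_of_isSelfAdjoint (hU : IsIrreducibleProjRep m U) {T : H →L[ℂ] H}
    (hT : IsSelfAdjoint T) (hc : ∀ x, Commute T (U x : H →L[ℂ] H)) : ∃ c : ℝ, T = (c : ℂ) • 1 := by
  have := hU.nontrivial
  obtain ⟨s, hs⟩ := ContinuousFunctionalCalculus.spectrum_nonempty (R := ℝ) T hT
  suffices h : spectrum ℝ T ⊆ {s} by
    refine ⟨s, ?_⟩
    rw [CFC.eq_algebraMap_of_spectrum_subset_singleton T s h, Algebra.algebraMap_eq_smul_one]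
    ext; simp
  -- Two spectral points on either side of `r` would make both the positive part `F` and the
  -- negative part `G` of `T - r` nonzero. Then `ker F` is closed and invariant, contains the range
  -- of `G`, and is not everything.
  have key : ∀ s ∈ spectrum ℝ T, ∀ t ∈ spectrum ℝ T, ¬ s < t := by
    intro s hs t ht hst
    set r := (s + t) / 2 with hr
    have hf : Continuous fun u : ℝ => max (u - r) 0 := by fun_prop
    have hg : Continuous fun u : ℝ => max (r - u) 0 := by fun_prop
    set F := cfc (fun u : ℝ => max (u - r) 0) T with hF
    set G := cfc (fun u : ℝ => max (r - u) 0) T with hG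
    have hFG : F * G = 0 := by
      rw [hF, hG, ← cfc_mul _ _ T hf.continuousOn hg.continuousOn, ← cfc_zero ℝ T]
      congr 1
      funext u
      rcases le_total u r with h | h
      · simp [max_eq_right (sub_nonpos.2 h)]
      · simp [max_eq_right (sub_nonpos.2 h)]
    have hne : ∀ f : ℝ → ℝ, Continuous f → ∀ v ∈ spectrum ℝ T, f v ≠ 0 → cfc f T ≠ 0 := by
      intro f hf v hv hfv h0
      have h1 : f v ∈ spectrum ℝ (cfc f T) := by
        rw [cfc_map_spectrum f T hT hf.continuousOn]
        exact ⟨v, hv, rfl⟩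
      rw [h0, spectrum.zero_eq] at h1
      exact hfv h1
    have hF0 : F ≠ 0 := hne _ hf t ht (by
      rw [max_eq_left (by linarith)]; intro h; linarith)
    have hG0 : G ≠ 0 := hne _ hg s hs (by
      rw [max_eq_left (by linarith)]; intro h; linarith)
    have hFc : ∀ x, Commute F (U x : H →L[ℂ] H) := fun x =>
      (hT.commute_cfc (hc x) _)
    rcases hU.irreducible (LinearMap.ker (F : H →ₗ[ℂ] H)) (ContinuousLinearMap.isClosed_ker F)
      (fun x φ hφ => by
        have h1 : F φ = 0 := hφ
        change F ((U x : H →L[ℂ] H) φ) = 0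
        rw [← mul_apply_eq_comp, (hFc x).eq, mul_apply_eq_comp, h1, map_zero]) with h | h
    · apply hG0
      ext v
      have h1 : G v ∈ LinearMap.ker (F : H →ₗ[ℂ] H) := by
        change (F * G) v = 0
        rw [hFG]; rfl
      rw [h] at h1
      exact h1
    · apply hF0
      ext v
      have : v ∈ LinearMap.ker (F : H →ₗ[ℂ] H) := h ▸ Submodule.mem_top
      exact this
  intro t ht
  exact le_antisymm (not_lt.1 (key s hs t ht)) (not_lt.1 (key t ht s hs))

end IsIrreducibleProjRep

end Schur

/-! ### Matrix coefficients and their graph in `L²` -/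

section Coeff

variable {H : Type*} [NormedAddCommGroup H] [InnerProductSpace ℂ H] [CompleteSpace H]
  {Ξ : Type*} [AddCommGroup Ξ] [TopologicalSpace Ξ] {m : Ξ → Ξ → Circle}
  {U : Ξ → unitary (H →L[ℂ] H)}

/-- The matrix coefficient `x ↦ ⟨U_x φ, a⟩`, linear in `a`. -/
def coeff (U : Ξ → unitary (H →L[ℂ] H)) (φ a : H) (x : Ξ) : ℂ := ⟪(U x : H →L[ℂ] H) φ, a⟫_ℂ

theorem conj_coeff (φ a : H) (x : Ξ) :
    (starRingEnd ℂ) (coeff U φ a x) = ⟪a, (U x : H →L[ℂ] H) φ⟫_ℂ := inner_conj_symm _ _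

theorem IsIrreducibleProjRep.continuous_coeff (hU : IsIrreducibleProjRep m U) (φ a : H) :
    Continuous (coeff U φ a) := (hU.continuous φ).inner continuous_const

/-- Moving the vector by `U_y` translates the coefficient by `y`, up to a phase that depends only on
the multiplier. -/
theorem IsIrreducibleProjRep.coeff_apply (hU : IsIrreducibleProjRep m U) (φ a : H) (x y : Ξ) :
    coeff U φ ((U y : H →L[ℂ] H) a) x = (m y (x - y) : ℂ) * coeff U φ a (x - y) := by
  unfold coeff
  rw [hU.apply_eq_smul_apply_sub x y, inner_circle_smul_left, inv_inv, inner_unitary_unitary]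

theorem IsIrreducibleProjRep.norm_coeff_neg (hU : IsIrreducibleProjRep m U) (φ a : H) (x : Ξ) :
    ‖coeff U φ a (-x)‖ = ‖coeff U a φ x‖ := by
  unfold coeff
  rw [← inner_unitary_unitary (U x), hU.apply_neg_apply, inner_circle_smul_left, norm_mul,
    Circle.norm_coe, one_mul, norm_inner_symm]

/-- Polarization with `x + y` and `x + iy`. -/
theorem sesquilinear_eq_zero {B : H → H → ℂ}
    (hal : ∀ x y z, B (x + y) z = B x z + B y z) (har : ∀ x y z, B x (y + z) = B x y + B x z)
    (hsl : ∀ (c : ℂ) x y, B (c • x) y = (starRingEnd ℂ) c * B x y)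
    (hsr : ∀ (c : ℂ) x y, B x (c • y) = c * B x y) (h0 : ∀ x, B x x = 0) (x y : H) :
    B x y = 0 := by
  have h1 := h0 (x + y)
  have h2 := h0 (x + Complex.I • y)
  simp only [hal, har, hsl, hsr, h0, Complex.conj_I] at h1 h2
  linear_combination (1 / 2 : ℂ) * h1 + (-Complex.I / 2) * h2 + (1 / 2 : ℂ) * (B x y - B y x) * Complex.I_sq

variable [IsTopologicalAddGroup Ξ] [MeasurableSpace Ξ] [BorelSpace Ξ]
  {μ : Measure Ξ}

theorem IsIrreducibleProjRep.aestronglyMeasurable_coeff (hU : IsIrreducibleProjRep m U)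
    (φ a : H) : AEStronglyMeasurable (coeff U φ a) μ :=
  (hU.continuous_coeff φ a).aestronglyMeasurable

/-- The graph of the closed operator `a ↦ ⟨U_x φ, a⟩` from `H` to `L²`. -/
def coeffGraph (μ : Measure Ξ) (U : Ξ → unitary (H →L[ℂ] H)) (φ : H) :
    Submodule ℂ (WithLp 2 (H × Lp ℂ 2 μ)) where
  carrier := {p | p.snd =ᵐ[μ] coeff U φ p.fst}
  zero_mem' := by
    change ((0 : Lp ℂ 2 μ) : Ξ → ℂ) =ᵐ[μ] _
    filter_upwards [Lp.coeFn_zero ℂ 2 μ] with x hx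
    rw [hx]
    simp [coeff]
  add_mem' := by
    intro p q hp hq
    change ((p.snd + q.snd : Lp ℂ 2 μ) : Ξ → ℂ) =ᵐ[μ] _
    filter_upwards [Lp.coeFn_add p.snd q.snd, hp, hq] with x hx h1 h2
    rw [hx, Pi.add_apply, h1, h2]
    exact (inner_add_right _ _ _).symm
  smul_mem' := by
    intro c p hp
    change ((c • p.snd : Lp ℂ 2 μ) : Ξ → ℂ) =ᵐ[μ] _
    filter_upwards [Lp.coeFn_smul c p.snd, hp] with x hx h1
    rw [hx, Pi.smul_apply, h1]
    exact (inner_smul_right _ _ _).symm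

/-- An `L²`-convergent sequence has a subsequence converging almost everywhere, while convergence of
the vectors makes their coefficients converge pointwise. -/
theorem isClosed_coeffGraph (φ : H) :
    IsClosed (coeffGraph μ U φ : Set (WithLp 2 (H × Lp ℂ 2 μ))) := by
  refine IsSeqClosed.isClosed fun p q hp hpq => ?_
  have h1 : Filter.Tendsto (fun n => (p n).fst) Filter.atTop (nhds q.fst) :=
    ((WithLp.prod_continuous_ofLp 2 H (Lp ℂ 2 μ)).fst.tendsto q).comp hpq
  have h2 : Filter.Tendsto (fun n => (p n).snd) Filter.atTop (nhds q.snd) :=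
    ((WithLp.prod_continuous_ofLp 2 H (Lp ℂ 2 μ)).snd.tendsto q).comp hpq
  obtain ⟨ns, hns, hae⟩ := (tendstoInMeasure_of_tendsto_Lp h2).exists_seq_tendsto_ae
  have h3 : ∀ᵐ x ∂μ, ∀ n, (p n).snd x = coeff U φ (p n).fst x := ae_all_iff.2 fun n => hp n
  filter_upwards [hae, h3] with x hx h4
  refine tendsto_nhds_unique hx ?_
  simp_rw [h4]
  exact (tendsto_const_nhds.inner (h1.comp hns.tendsto_atTop))

variable [μ.IsAddHaarMeasure]

/-- Both coefficients acquire the same phase because `U` and `V` share the multiplier; the phases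
cancel, and translation invariance does the rest. The case `V = U` serves the orthogonality
relations, the case `V_x = U_{-x}` the construction of the reflection. -/
theorem IsIrreducibleProjRep.integral_coeff_apply (hU : IsIrreducibleProjRep m U)
    {V : Ξ → unitary (H →L[ℂ] H)} (hV : IsIrreducibleProjRep m V) (φ ψ a b : H) (y : Ξ) :
    ∫ x, (starRingEnd ℂ) (coeff U φ ((U y : H →L[ℂ] H) a) x) *
      coeff V ψ ((V y : H →L[ℂ] H) b) x ∂μ =
    ∫ x, (starRingEnd ℂ) (coeff U φ a x) * coeff V ψ b x ∂μ := by
  rw [← integral_sub_right_eq_self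
    (fun x => (starRingEnd ℂ) (coeff U φ a x) * coeff V ψ b x) y]
  refine integral_congr_ae (.of_forall fun x => ?_)
  simp only [hU.coeff_apply, hV.coeff_apply, map_mul]
  rw [← Circle.coe_inv_eq_conj]
  have : ((m y (x - y))⁻¹ : Circle) * (m y (x - y) : ℂ) = 1 := by
    rw [← Circle.coe_mul, inv_mul_cancel, Circle.coe_one]
  linear_combination ((starRingEnd ℂ) (coeff U φ a (x - y)) * coeff V ψ b (x - y)) * this

theorem IsIrreducibleProjRep.memLp_coeff_apply (hU : IsIrreducibleProjRep m U) {φ a : H}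
    (h : MemLp (coeff U φ a) 2 μ) (y : Ξ) : MemLp (coeff U φ ((U y : H →L[ℂ] H) a)) 2 μ := by
  refine (memLp_congr_norm (hU.aestronglyMeasurable_coeff _ _)
    ((hU.continuous_coeff φ a).comp (continuous_sub_right y)).aestronglyMeasurable
    (.of_forall fun x => ?_)).2
    (h.comp_measurePreserving (measurePreserving_sub_right μ y))
  rw [hU.coeff_apply, norm_mul, Circle.norm_coe, one_mul]
  rfl

end Coeff

/-! ### Orthogonality relations -/

section Orthogonality

variable {H : Type*} [NormedAddCommGroup H] [InnerProductSpace ℂ H] [CompleteSpace H]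
  {Ξ : Type*} [AddCommGroup Ξ] [TopologicalSpace Ξ] {m : Ξ → Ξ → Circle}
  {U : Ξ → unitary (H →L[ℂ] H)}

theorem inner_self_eq_ofReal (x : H) : ⟪x, x⟫_ℂ = ((‖x‖ ^ 2 : ℝ) : ℂ) := by
  rw [inner_self_eq_norm_sq_to_K]; norm_cast

theorem IsIrreducibleProjRep.star_apply (hU : IsIrreducibleProjRep m U) (y : Ξ) (φ : H) :
    star (U y : H →L[ℂ] H) φ =
      (((m y (-y) * m 0 0)⁻¹ : Circle) : ℂ) • (U (-y) : H →L[ℂ] H) φ := by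
  rw [← star_apply_unitary_apply (U y) ((U (-y) : H →L[ℂ] H) φ), hU.apply_neg_apply, map_smul,
    smul_smul, ← Circle.coe_mul, inv_mul_cancel, Circle.coe_one, one_smul]

variable [MeasurableSpace Ξ] {μ : Measure Ξ}

/-- A vector with square integrable coefficient function, as an element of the graph. -/
def coeffGraph.mk {φ a : H} (h : MemLp (coeff U φ a) 2 μ) : coeffGraph μ U φ :=
  ⟨WithLp.toLp 2 (a, h.toLp _), h.coeFn_toLp⟩

theorem coeffGraph.memLp {φ : H} (p : coeffGraph μ U φ) :
    MemLp (coeff U φ (p : WithLp 2 (H × Lp ℂ 2 μ)).fst) 2 μ :=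
  (memLp_congr_ae p.2).1 (Lp.memLp _)

theorem coeffGraph.inner_eq {φ : H} (p q : coeffGraph μ U φ) :
    ⟪p, q⟫_ℂ = ⟪(p : WithLp 2 (H × Lp ℂ 2 μ)).fst, (q : WithLp 2 (H × Lp ℂ 2 μ)).fst⟫_ℂ +
      ∫ x, (starRingEnd ℂ) (coeff U φ (p : WithLp 2 (H × Lp ℂ 2 μ)).fst x) *
        coeff U φ (q : WithLp 2 (H × Lp ℂ 2 μ)).fst x ∂μ := by
  rw [Submodule.coe_inner, WithLp.prod_inner_apply, MeasureTheory.L2.inner_def]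
  congr 1
  refine integral_congr_ae ?_
  filter_upwards [p.2, q.2] with x hp hq
  rw [← hp, ← hq, RCLike.inner_apply']
  rfl

theorem integral_norm_sq_eq_re (f : Ξ → ℂ) :
    ((∫ x, ‖f x‖ ^ 2 ∂μ : ℝ) : ℂ) = ∫ x, (starRingEnd ℂ) (f x) * f x ∂μ := by
  rw [← integral_complex_ofReal]
  congr 1
  funext x
  rw [RCLike.conj_mul]
  norm_cast

variable [IsTopologicalAddGroup Ξ] [BorelSpace Ξ] [μ.IsAddHaarMeasure]

theorem IsIrreducibleProjRep.memLp_coeff_star_apply (hU : IsIrreducibleProjRep m U) {φ a : H}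
    (h : MemLp (coeff U φ a) 2 μ) (y : Ξ) :
    MemLp (coeff U φ (star (U y : H →L[ℂ] H) a)) 2 μ := by
  have h1 := (hU.memLp_coeff_apply h (-y)).const_mul (((m y (-y) * m 0 0)⁻¹ : Circle) : ℂ)
  rw [hU.star_apply]
  convert h1 using 1
  funext x
  exact inner_smul_right _ _ _

/-- Schur's lemma for the possibly unbounded map `a ↦ coeff U φ a`, made bounded by passing to its
graph. The projection `π` of the graph to `H` is bounded, and `π π*` commutes with all `U_y`, so it
is a scalar `c`. As `c ≠ 0`, `π` is onto, which means that all coefficients are in `L²`; comparing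
norms gives `c (‖a‖² + ‖coeff‖²) = ‖a‖²`. -/
theorem IsIrreducibleProjRep.exists_integral_coeff_eq_mul (hU : IsIrreducibleProjRep m U)
    {φ a₀ : H} (ha₀ : a₀ ≠ 0) (h₀ : MemLp (coeff U φ a₀) 2 μ) :
    ∃ C : ℝ, ∀ a, MemLp (coeff U φ a) 2 μ ∧ ∫ x, ‖coeff U φ a x‖ ^ 2 ∂μ = C * ‖a‖ ^ 2 := by
  have : CompleteSpace (coeffGraph μ U φ) := (isClosed_coeffGraph φ).completeSpace_coe
  let π : coeffGraph μ U φ →L[ℂ] H :=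
    (ContinuousLinearMap.fst ℂ H (Lp ℂ 2 μ)) ∘L
      (WithLp.prodContinuousLinearEquiv 2 ℂ H (Lp ℂ 2 μ) : _ →L[ℂ] H × Lp ℂ 2 μ) ∘L
      (coeffGraph μ U φ).subtypeL
  have hπ : ∀ p, π p = (p : WithLp 2 (H × Lp ℂ 2 μ)).fst := fun p => rfl
  let J := ContinuousLinearMap.adjoint π
  have hJ : ∀ h q, ⟪J h, q⟫_ℂ = ⟪h, π q⟫_ℂ := fun h q =>
    ContinuousLinearMap.adjoint_inner_left _ _ _
  let T : H →L[ℂ] H := π ∘L J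
  have hTsa : IsSelfAdjoint T := by
    rw [IsSelfAdjoint, ContinuousLinearMap.star_eq_adjoint, ContinuousLinearMap.adjoint_comp,
      ContinuousLinearMap.adjoint_adjoint]
  have hTc : ∀ y, Commute T (U y : H →L[ℂ] H) := by
    intro y
    ext h
    set p := J h with hp
    let p' : coeffGraph μ U φ := coeffGraph.mk (hU.memLp_coeff_apply (coeffGraph.memLp p) y)
    suffices hs : J ((U y : H →L[ℂ] H) h) = p' by
      change π (J ((U y : H →L[ℂ] H) h)) = (U y : H →L[ℂ] H) (π (J h))
      rw [hs]; rfl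
    -- The inner product of the graph is invariant under `U_y`, so `U_y` can be moved from `p'` to
    -- `q` as its adjoint.
    refine ext_inner_right ℂ fun q => ?_
    let q' : coeffGraph μ U φ := coeffGraph.mk (hU.memLp_coeff_star_apply (coeffGraph.memLp q) y)
    have e1 : ⟪p, q'⟫_ℂ = ⟪h, star (U y : H →L[ℂ] H) (π q)⟫_ℂ := hJ h q'
    have e2 : ⟪p', q⟫_ℂ = ⟪p, q'⟫_ℂ := by
      rw [coeffGraph.inner_eq, coeffGraph.inner_eq]
      change ⟪(U y : H →L[ℂ] H) (π p), π q⟫_ℂ + ∫ x, (starRingEnd ℂ) (coeff U φ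
        ((U y : H →L[ℂ] H) (π p)) x) * coeff U φ (π q) x ∂μ = ⟪π p, star (U y : H →L[ℂ] H) (π q)⟫_ℂ
        + ∫ x, (starRingEnd ℂ) (coeff U φ (π p) x) *
          coeff U φ (star (U y : H →L[ℂ] H) (π q)) x ∂μ
      rw [inner_star_unitary_apply_right]
      nth_rewrite 2 [← unitary_apply_star_apply (U y) (π q)]
      rw [hU.integral_coeff_apply hU]
    rw [hJ, e2, e1, inner_star_unitary_apply_right]
  obtain ⟨c, hc⟩ := hU.eq_smul_one_of_isSelfAdjoint hTsa hTc
  have hTa : ∀ h, π (J h) = (c : ℂ) • h := fun h => by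
    change T h = _
    rw [hc]; rfl
  have hc0 : c ≠ 0 := by
    intro h0
    have h1 : ∀ h, J h = 0 := fun h => by
      rw [← inner_self_eq_zero (𝕜 := ℂ), hJ, hTa, h0]; simp
    have h2 := hJ a₀ (coeffGraph.mk h₀)
    rw [h1, inner_zero_left] at h2
    exact ha₀ (inner_self_eq_zero.1 h2.symm)
  have hmem : ∀ a, MemLp (coeff U φ a) 2 μ := by
    intro a
    have h1 : π (J ((c : ℂ)⁻¹ • a)) = a := by
      rw [hTa, smul_smul, mul_inv_cancel₀ (by exact_mod_cast hc0), one_smul]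
    rw [← h1]
    exact coeffGraph.memLp (J ((c : ℂ)⁻¹ • a))
  refine ⟨c⁻¹ - 1, fun a => ⟨hmem a, ?_⟩⟩
  let p : coeffGraph μ U φ := coeffGraph.mk (hmem a)
  have hπp : π p = a := rfl
  have hinj : ∀ q : coeffGraph μ U φ, π q = 0 → q = 0 := by
    intro q hq
    rw [← inner_self_eq_zero (𝕜 := ℂ), coeffGraph.inner_eq, ← hπ, hq]
    simp [coeff]
  -- A point of the graph is determined by its first component, and both sides have first component
  -- `c a`.
  have hJp : J a = (c : ℂ) • p := by
    rw [← sub_eq_zero]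
    apply hinj
    rw [map_sub, hTa, map_smul, hπp, sub_self]
  have h3 := hJ a p
  rw [hJp, hπp] at h3
  replace h3 := (inner_smul_left p p (c : ℂ)).symm.trans h3
  rw [Complex.conj_ofReal, coeffGraph.inner_eq, ← hπ, hπp,
    ← integral_norm_sq_eq_re, inner_self_eq_ofReal] at h3
  have h4 : c * (‖a‖ ^ 2 + ∫ x, ‖coeff U φ a x‖ ^ 2 ∂μ) = ‖a‖ ^ 2 := by exact_mod_cast h3
  field_simp
  linarith

variable [LocallyCompactSpace Ξ] [μ.Regular]

/-- All coefficients are square integrable. -/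
theorem IsIrreducibleProjRep.exists_integral_norm_coeff_sq (hU : IsIrreducibleProjRep m U)
    (hsq : IsSquareIntegrable μ U) :
    ∃ k : ℝ, k ≠ 0 ∧ ∀ φ a, MemLp (coeff U φ a) 2 μ ∧
      ∫ x, ‖coeff U φ a x‖ ^ 2 ∂μ = k * ‖φ‖ ^ 2 * ‖a‖ ^ 2 := by
  obtain ⟨φ₀, ψ₀, hφ, hψ, hmem⟩ := hsq
  have hconj : MemLp (coeff U φ₀ ψ₀) 2 μ :=
    (memLp_congr_norm (hU.aestronglyMeasurable_coeff _ _) hmem.1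
      (.of_forall fun x => norm_inner_symm _ _)).2 hmem
  -- As `U_{-x}` is `U_x*` up to a phase, `x ↦ -x` exchanges the two vectors in the absolute value
  -- of a coefficient. Square integrability thus spreads from one pair of vectors to all pairs, and
  -- the constant is quadratic in each.
  have hswap : ∀ φ a, MemLp (coeff U φ a) 2 μ → MemLp (coeff U a φ) 2 μ := fun φ a h =>
    (memLp_congr_norm (hU.aestronglyMeasurable_coeff _ _)
      ((hU.continuous_coeff φ a).comp continuous_neg).aestronglyMeasurable
      (.of_forall fun x => (hU.norm_coeff_neg φ a x).symm)).2
      (h.comp_measurePreserving (Measure.measurePreserving_neg μ))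
  have hint : ∀ φ a, ∫ x, ‖coeff U φ a x‖ ^ 2 ∂μ = ∫ x, ‖coeff U a φ x‖ ^ 2 ∂μ := fun φ a => by
    rw [← integral_neg_eq_self]
    simp_rw [hU.norm_coeff_neg]
  obtain ⟨C₀, hC₀⟩ := hU.exists_integral_coeff_eq_mul hψ hconj
  have h1 : ∀ a, ∃ C : ℝ, ∀ b, MemLp (coeff U a b) 2 μ ∧
      ∫ x, ‖coeff U a b x‖ ^ 2 ∂μ = C * ‖b‖ ^ 2 := fun a =>
    hU.exists_integral_coeff_eq_mul hφ (hswap _ _ (hC₀ a).1)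
  choose C hC using h1
  have hφn : ‖φ₀‖ ^ 2 ≠ 0 := pow_ne_zero _ (norm_ne_zero_iff.2 hφ)
  have hCa : ∀ a, C a = C φ₀ / ‖φ₀‖ ^ 2 * ‖a‖ ^ 2 := fun a => by
    have h2 := hint a φ₀
    rw [(hC _ _).2, (hC _ _).2] at h2
    field_simp
    exact h2
  have hall : ∀ φ a, MemLp (coeff U φ a) 2 μ ∧
      ∫ x, ‖coeff U φ a x‖ ^ 2 ∂μ = C φ₀ / ‖φ₀‖ ^ 2 * ‖φ‖ ^ 2 * ‖a‖ ^ 2 := fun φ a => by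
    rw [← hCa]; exact hC φ a
  refine ⟨C φ₀ / ‖φ₀‖ ^ 2, fun h0 => ?_, hall⟩
  -- If `k` were zero, this continuous coefficient would vanish identically, but its value at `0` is
  -- `‖φ₀‖²`.
  obtain ⟨h2, h3⟩ := hall φ₀ ((U 0 : H →L[ℂ] H) φ₀)
  rw [h0, zero_mul, zero_mul, integral_eq_zero_iff_of_nonneg (fun _ => sq_nonneg _)
    (h2.integrable_norm_pow two_ne_zero)] at h3
  have h4 := (Continuous.ae_eq_iff_eq μ ((hU.continuous_coeff _ _).norm.pow 2)
    continuous_zero).1 h3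
  have h5 := congrFun h4 0
  have h6 : ‖coeff U φ₀ ((U 0 : H →L[ℂ] H) φ₀) 0‖ ^ 2 = 0 := h5
  rw [coeff, inner_unitary_unitary, sq_eq_zero_iff, norm_eq_zero, inner_self_eq_zero] at h6
  exact hφ h6

/-- The orthogonality relations. -/
theorem IsIrreducibleProjRep.exists_orthogonality (hU : IsIrreducibleProjRep m U)
    (hsq : IsSquareIntegrable μ U) :
    ∃ k : ℝ, k ≠ 0 ∧ (∀ φ a, MemLp (coeff U φ a) 2 μ ∧
        ∫ x, ‖coeff U φ a x‖ ^ 2 ∂μ = k * ‖φ‖ ^ 2 * ‖a‖ ^ 2) ∧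
      ∀ φ a ψ b, ∫ x, ⟪a, (U x : H →L[ℂ] H) φ⟫_ℂ * ⟪(U x : H →L[ℂ] H) ψ, b⟫_ℂ ∂μ =
        k * ⟪a, b⟫_ℂ * ⟪ψ, φ⟫_ℂ := by
  obtain ⟨k, hk, h⟩ := hU.exists_integral_norm_coeff_sq hsq
  refine ⟨k, hk, h, fun φ a ψ b => ?_⟩
  have hint : ∀ φ a ψ b, Integrable
      (fun x => ⟪a, (U x : H →L[ℂ] H) φ⟫_ℂ * ⟪(U x : H →L[ℂ] H) ψ, b⟫_ℂ) μ := fun φ a ψ b => by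
    have h1 : MemLp (fun x => ⟪a, (U x : H →L[ℂ] H) φ⟫_ℂ) 2 μ :=
      (memLp_congr_norm (continuous_const.inner (hU.continuous φ)).aestronglyMeasurable
        (hU.aestronglyMeasurable_coeff φ a)
        (.of_forall fun x => norm_inner_symm _ _)).2 (h φ a).1
    exact h1.integrable_mul (h ψ b).1
  -- Polarization is used twice: here in `a, b` with `φ = ψ`, below in `ψ, φ`.
  have h1 : ∀ φ a b, ∫ x, ⟪a, (U x : H →L[ℂ] H) φ⟫_ℂ * ⟪(U x : H →L[ℂ] H) φ, b⟫_ℂ ∂μ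
      - k * ⟪a, b⟫_ℂ * ⟪φ, φ⟫_ℂ = 0 := fun φ => by
    refine sesquilinear_eq_zero (fun x y z => ?_) (fun x y z => ?_) (fun c x y => ?_)
      (fun c x y => ?_) (fun x => ?_)
    · simp_rw [inner_add_left, add_mul]
      rw [integral_add (hint _ _ _ _) (hint _ _ _ _)]
      ring
    · simp_rw [inner_add_right, mul_add]
      rw [integral_add (hint _ _ _ _) (hint _ _ _ _)]
      ring
    · simp_rw [inner_smul_left, mul_assoc]
      rw [integral_const_mul]
      ring
    · simp_rw [inner_smul_right, mul_left_comm _ c]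
      rw [integral_const_mul]
      ring
    · have h2 := congrArg (fun r : ℝ => (r : ℂ)) (h φ x).2
      simp only [integral_norm_sq_eq_re, conj_coeff] at h2
      rw [sub_eq_zero]
      refine h2.trans ?_
      rw [inner_self_eq_ofReal, inner_self_eq_ofReal]
      push_cast
      ring
  refine sub_eq_zero.1 ?_
  refine sesquilinear_eq_zero (B := fun ψ φ => ∫ x, ⟪a, (U x : H →L[ℂ] H) φ⟫_ℂ *
    ⟪(U x : H →L[ℂ] H) ψ, b⟫_ℂ ∂μ - k * ⟪a, b⟫_ℂ * ⟪ψ, φ⟫_ℂ)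
    (fun x y z => ?_) (fun x y z => ?_) (fun c x y => ?_) (fun c x y => ?_) (fun x => ?_) ψ φ
  · simp_rw [map_add, inner_add_left, mul_add]
    rw [integral_add (hint _ _ _ _) (hint _ _ _ _)]
    ring
  · simp_rw [map_add, inner_add_right, add_mul, mul_add]
    rw [integral_add (hint _ _ _ _) (hint _ _ _ _)]
    ring
  · simp_rw [map_smul, inner_smul_left, mul_left_comm _ ((starRingEnd ℂ) c)]
    rw [integral_const_mul]
    ring
  · simp_rw [map_smul, inner_smul_right, mul_assoc]
    rw [integral_const_mul]
    ring
  · exact h1 x a b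

end Orthogonality

/-! ### Uniqueness of Fourier transforms on `L¹` -/

section FourierUniqueness

variable {Ξ : Type*} [AddCommGroup Ξ] [TopologicalSpace Ξ] [MeasurableSpace Ξ] [BorelSpace Ξ]
  {μ : Measure Ξ}

theorem integrable_circle_mul {f : Ξ → ℂ} (hf : Integrable f μ) {c : Ξ → Circle}
    (hc : Continuous c) : Integrable (fun x => f x * c x) μ :=
  hf.mul_bdd (c := 1) (continuous_subtype_val.comp hc).aestronglyMeasurable
    (.of_forall fun _ => (Circle.norm_coe _).le)

/-- For an indicator of `t`, take a compact `s ⊆ t` and an open `V ⊇ s` and a Urysohn function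
between them; compactness of `s` replaces normality. The error lives on `(t \ s) ∪ (V \ s)` and is
bounded there by `‖c‖`. -/
theorem exists_continuous_eLpNorm_sub_le [T2Space Ξ] [LocallyCompactSpace Ξ] [μ.Regular]
    {f : Ξ → ℂ} (hf : MemLp f 1 μ) {ε : ℝ≥0∞} (hε : ε ≠ 0) :
    ∃ g : Ξ → ℂ, eLpNorm (f - g) 1 μ ≤ ε ∧ Continuous g ∧ HasCompactSupport g := by
  refine hf.induction_dense ENNReal.one_ne_top _ ?_ ?_ ?_ hε
  · intro c t ht htμ ε hε
    obtain ⟨η, ηpos, hη⟩ := exists_eLpNorm_indicator_le (μ := μ) ENNReal.one_ne_top c hε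
    have hη2 : ((η : ℝ≥0∞) / 2) ≠ 0 := by
      simpa using ηpos.ne'
    obtain ⟨s, st, s_compact, s_closed, μs⟩ :
        ∃ s, s ⊆ t ∧ IsCompact s ∧ IsClosed s ∧ μ (t \ s) < η / 2 :=
      ht.exists_isCompact_isClosed_sdiff_lt htμ.ne hη2
    obtain ⟨V, sV, V_open, -, hV⟩ : ∃ V : Set Ξ, V ⊇ s ∧ IsOpen V ∧ μ V < ∞ ∧ μ (V \ s) < η / 2 :=
      s_closed.measurableSet.exists_isOpen_sdiff_lt
        ((measure_mono st).trans_lt htμ).ne hη2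
    obtain ⟨u, hu1, hu0, huc, hu01⟩ := exists_continuous_one_zero_of_isCompact s_compact
      V_open.isClosed_compl (Set.disjoint_compl_right_iff_subset.2 sV)
    have hμ : μ ((t \ s) ∪ (V \ s)) ≤ η :=
      (measure_union_le _ _).trans ((add_le_add μs.le hV.le).trans (ENNReal.add_halves _).le)
    refine ⟨fun x => (u x : ℂ) * c, (eLpNorm_mono fun x => ?_).trans (hη _ hμ),
      (Complex.continuous_ofReal.comp u.continuous).mul continuous_const, ?_⟩
    · by_cases hx : x ∈ (t \ s) ∪ (V \ s)
      · rw [Set.indicator_of_mem hx, Pi.sub_apply]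
        have h1 := (hu01 x).1
        have h2 := (hu01 x).2
        have h3 : ∀ r : ℝ, |r| ≤ 1 → ‖(r : ℂ) * c‖ ≤ ‖c‖ := fun r hr => by
          rw [norm_mul, Complex.norm_real]
          exact mul_le_of_le_one_left (norm_nonneg _) hr
        by_cases hxt : x ∈ t
        · rw [Set.indicator_of_mem hxt]
          have h4 := h3 (u x - 1) (abs_le.2 ⟨by linarith, by linarith⟩)
          rwa [Complex.ofReal_sub, Complex.ofReal_one, sub_mul, one_mul] at h4
        · rw [Set.indicator_of_notMem hxt, sub_zero]
          exact h3 (u x) (abs_le.2 ⟨by linarith, by linarith⟩)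
      · rw [Set.indicator_of_notMem hx, Pi.sub_apply]
        by_cases hxs : x ∈ s
        · rw [Set.indicator_of_mem (st hxs), hu1 hxs]
          simp
        · simp only [Set.mem_union, Set.mem_sdiff, hxs, not_false_eq_true, and_true, not_or] at hx
          rw [Set.indicator_of_notMem hx.1, hu0 hx.2]
          simp
    · exact (huc.comp_left (g := fun r : ℝ => (r : ℂ)) Complex.ofReal_zero).mul_right
  · rintro f g ⟨hf, hf'⟩ ⟨hg, hg'⟩
    exact ⟨hf.add hg, hf'.add hg'⟩
  · rintro f ⟨hf, -⟩
    exact hf.aestronglyMeasurable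

/-- Density of `C_c` in `L¹`; the space is not assumed to be normal. -/
theorem exists_continuous_integral_sub_le [T2Space Ξ] [LocallyCompactSpace Ξ] [μ.Regular]
    {f : Ξ → ℂ} (hf : Integrable f μ) {ε : ℝ} (hε : 0 < ε) :
    ∃ g : Ξ → ℂ, HasCompactSupport g ∧ (∫ x, ‖f x - g x‖ ∂μ) ≤ ε ∧
      Continuous g ∧ Integrable g μ := by
  obtain ⟨g, hg, hgc, hgs⟩ := exists_continuous_eLpNorm_sub_le (memLp_one_iff_integrable.2 hf)
    (ENNReal.ofReal_pos.2 hε).ne'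
  have hgi : Integrable g μ := hgc.integrable_of_hasCompactSupport hgs
  refine ⟨g, hgs, ?_, hgc, hgi⟩
  rw [eLpNorm_one_eq_lintegral_enorm] at hg
  rw [← ENNReal.ofReal_le_ofReal_iff hε.le]
  exact (ofReal_integral_norm_eq_lintegral_enorm (hf.sub hgi)).trans_le hg

/-- The evaluation map into the product of circles given by a family of characters. -/
def charEval (χ : Ξ → Ξ → Circle) (x : Ξ) : Ξ → Circle := fun y => χ y x

theorem continuous_charEval {χ : Ξ → Ξ → Circle} (hc : ∀ y, Continuous (χ y)) :
    Continuous (charEval χ) := continuous_pi hc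

theorem charEval_injective {χ : Ξ → Ξ → Circle}
    (hsep : ∀ x x', (∀ y, χ y x = χ y x') → x = x') : Function.Injective (charEval χ) :=
  fun x x' h => hsep x x' fun y => congrFun h y

/-- Functions on the product of circles that restrict to one of the characters. -/
def charMonoid (χ : Ξ → Ξ → Circle) (hadd : ∀ y y' x, χ (y + y') x = χ y x * χ y' x) :
    Submonoid C(Ξ → Circle, ℂ) where
  carrier := {p | ∃ y, ∀ x, p (charEval χ x) = χ y x}
  one_mem' := ⟨0, fun x => by
    have h := hadd 0 0 x
    rw [add_zero, left_eq_mul] at h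
    rw [h]; simp⟩
  mul_mem' := by
    rintro p q ⟨y, hy⟩ ⟨y', hy'⟩
    exact ⟨y + y', fun x => by simp [hadd, hy, hy']⟩

theorem star_mem_charMonoid {χ : Ξ → Ξ → Circle}
    (hadd : ∀ y y' x, χ (y + y') x = χ y x * χ y' x) {p : C(Ξ → Circle, ℂ)}
    (hp : p ∈ charMonoid χ hadd) : star p ∈ charMonoid χ hadd := by
  obtain ⟨y, hy⟩ := hp
  refine ⟨-y, fun x => ?_⟩
  have h0 : χ 0 x = 1 := by
    have h := hadd 0 0 x
    rwa [add_zero, left_eq_mul] at h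
  have h1 : χ (-y) x = (χ y x)⁻¹ := by
    rw [eq_inv_iff_mul_eq_one, ← hadd, neg_add_cancel, h0]
  rw [h1, Circle.coe_inv_eq_conj, ContinuousMap.star_apply, hy]
  rfl

/-- The integral is a bounded functional of `p`, since `F` is integrable. It vanishes on a star
algebra containing the coordinate functions, which is dense by Stone-Weierstrass on the compact
product of circles. -/
theorem integral_mul_charEval_eq_zero {χ : Ξ → Ξ → Circle} (hc : ∀ y, Continuous (χ y))
    (hadd : ∀ y y' x, χ (y + y') x = χ y x * χ y' x) {F : Ξ → ℂ} (hF : Integrable F μ)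
    (h0 : ∀ y, ∫ x, F x * χ y x ∂μ = 0) (p : C(Ξ → Circle, ℂ)) :
    ∫ x, F x * p (charEval χ x) ∂μ = 0 := by
  have hint : ∀ p : C(Ξ → Circle, ℂ), Integrable (fun x => F x * p (charEval χ x)) μ := fun p =>
    hF.mul_bdd (c := ‖p‖) (p.continuous.comp (continuous_charEval hc)).aestronglyMeasurable
      (.of_forall fun x => p.norm_coe_le_norm _)
  let L : C(Ξ → Circle, ℂ) →L[ℂ] ℂ := LinearMap.mkContinuous
    { toFun := fun p => ∫ x, F x * p (charEval χ x) ∂μ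
      map_add' := fun p q => by
        rw [← integral_add (hint p) (hint q)]
        simp [mul_add]
      map_smul' := fun c p => by
        rw [RingHom.id_apply, smul_eq_mul, ← integral_const_mul]
        simp [mul_left_comm] } (∫ x, ‖F x‖ ∂μ) fun p => by
      refine (norm_integral_le_integral_norm _).trans ?_
      rw [← integral_mul_const]
      refine integral_mono (hint p).norm (hF.norm.mul_const _) fun x => ?_
      simp only [norm_mul]
      gcongr
      exact p.norm_coe_le_norm _
  let A : StarSubalgebra ℂ C(Ξ → Circle, ℂ) := StarAlgebra.adjoin ℂ (charMonoid χ hadd)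
  have hstar : (charMonoid χ hadd : Set C(Ξ → Circle, ℂ)) ∪
      star (charMonoid χ hadd : Set C(Ξ → Circle, ℂ)) = charMonoid χ hadd := by
    refine Set.union_eq_left.2 fun q hq => ?_
    have := star_mem_charMonoid hadd (Set.mem_star.1 hq)
    rwa [star_star] at this
  have hA : ∀ q ∈ A, L q = 0 := by
    intro q hq
    have h1 : q ∈ Submodule.span ℂ (charMonoid χ hadd : Set C(Ξ → Circle, ℂ)) := by
      have h2 : q ∈ A.toSubalgebra := hq
      rw [StarAlgebra.adjoin_toSubalgebra, hstar, ← Subalgebra.mem_toSubmodule,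
        Algebra.adjoin_eq_span, Submonoid.closure_eq] at h2
      exact h2
    clear hq
    induction h1 using Submodule.span_induction with
    | mem q hq =>
      obtain ⟨y, hy⟩ := hq
      change ∫ x, F x * q (charEval χ x) ∂μ = 0
      simp_rw [hy]
      exact h0 y
    | zero => exact map_zero L
    | add q r _ _ hq hr => rw [map_add, hq, hr, add_zero]
    | smul c q _ hq => rw [map_smul, hq, smul_zero]
  have hsepA : A.SeparatesPoints := by
    intro z z' hz
    obtain ⟨y, hy⟩ := Function.ne_iff.1 hz
    let q : C(Ξ → Circle, ℂ) := ⟨fun z => z y, continuous_subtype_val.comp (continuous_apply y)⟩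
    refine ⟨q, ⟨q, StarAlgebra.subset_adjoin ℂ _ ⟨y, fun x => rfl⟩, rfl⟩, ?_⟩
    exact fun h => hy (Subtype.val_injective h)
  have hdense := ContinuousMap.starSubalgebra_topologicalClosure_eq_top_of_separatesPoints A hsepA
  have hcl : closure (A : Set C(Ξ → Circle, ℂ)) ⊆ {q | L q = 0} :=
    closure_minimal hA (isClosed_eq L.continuous continuous_const)
  have hp : p ∈ closure (A : Set C(Ξ → Circle, ℂ)) := by
    rw [← StarSubalgebra.topologicalClosure_coe, hdense]
    trivial
  exact hcl hp

/-- Uniqueness of Fourier transforms with respect to a separating group of characters. -/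
theorem ae_eq_zero_of_integral_mul_char_eq_zero [IsTopologicalAddGroup Ξ] [T2Space Ξ]
    [LocallyCompactSpace Ξ] [μ.Regular] {χ : Ξ → Ξ → Circle}
    (hc : ∀ y, Continuous (χ y)) (hadd : ∀ y y' x, χ (y + y') x = χ y x * χ y' x)
    (hsep : ∀ x x', (∀ y, χ y x = χ y x') → x = x') {F : Ξ → ℂ} (hF : Integrable F μ)
    (h0 : ∀ y, ∫ x, F x * χ y x ∂μ = 0) : F =ᵐ[μ] 0 := by
  -- Test `F`, approximated by a compactly supported `w`, against a function `u` on the product of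
  -- circles, bounded by `1`, that nearly equals the conjugate phase of `w` on its support. Since `∫
  -- F u = 0`, the integral `∫ w u ≈ ∫ |w|` is at most `ε`.
  have key : ∀ ε > 0, ∫ x, ‖F x‖ ∂μ ≤ 2 * ε := by
    intro ε hε
    obtain ⟨w, hwc, hFw, hw, hwi⟩ := exists_continuous_integral_sub_le hF hε
    set K := tsupport w with hK
    have hKc : IsCompact K := hwc
    have hKm : MeasurableSet K := (isClosed_tsupport w).measurableSet
    have hKfin : μ K ≠ ∞ := hKc.measure_lt_top.ne
    have hFw_int : Integrable (fun x => F x - w x) μ := hF.sub hwi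
    have hwε : ∀ δ > 0, ∫ x, ‖w x‖ ∂μ ≤ ε + δ * μ.real K := by
      intro δ hδ
      have hpos : ∀ x, 0 < ‖w x‖ + δ := fun x => by positivity
      -- The term `δ` keeps the phase of `w` continuous at the zeros of `w`.
      let v : C(K, ℂ) := ⟨fun x => (starRingEnd ℂ) (w x) / ((‖w x‖ + δ : ℝ) : ℂ), by
        refine Continuous.div ?_ ?_ fun x => ?_
        · exact Complex.continuous_conj.comp (hw.comp continuous_subtype_val)
        · exact Complex.continuous_ofReal.comp
            ((hw.comp continuous_subtype_val).norm.add continuous_const)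
        · exact_mod_cast (hpos x).ne'⟩
      have hv : ∀ x, v x ∈ Metric.closedBall (0 : ℂ) 1 := fun x => by
        rw [mem_closedBall_zero_iff]
        change ‖(starRingEnd ℂ) (w x) / ((‖w x‖ + δ : ℝ) : ℂ)‖ ≤ 1
        rw [norm_div, RCLike.norm_conj, Complex.norm_real, Real.norm_of_nonneg (hpos x).le,
          div_le_one (hpos x)]
        linarith
      have : CompactSpace K := isCompact_iff_compactSpace.1 hKc
      -- On the compact set `K` the separating characters give an embedding, so Tietze extension
      -- with values in the closed disc applies.
      have hemb : Topology.IsClosedEmbedding fun x : K => charEval χ x :=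
        Continuous.isClosedEmbedding ((continuous_charEval hc).comp continuous_subtype_val)
          ((charEval_injective hsep).comp Subtype.val_injective)
      have : TietzeExtension (Metric.closedBall (0 : ℂ) 1) :=
        Metric.instTietzeExtensionClosedBall ℂ 0 one_pos
      obtain ⟨u, hu, huv⟩ := v.exists_extension_forall_mem hemb hv
      have hu1 : ∀ x, ‖u (charEval χ x)‖ ≤ 1 := fun x => mem_closedBall_zero_iff.1 (hu _)
      have huK : ∀ x (hx : x ∈ K), u (charEval χ x) =
          (starRingEnd ℂ) (w x) / ((‖w x‖ + δ : ℝ) : ℂ) := fun x hx =>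
        DFunLike.congr_fun huv ⟨x, hx⟩
      have hint : ∀ G : Ξ → ℂ, Integrable G μ →
          Integrable (fun x => G x * u (charEval χ x)) μ := fun G hG =>
        hG.mul_bdd (c := 1) (u.continuous.comp (continuous_charEval hc)).aestronglyMeasurable
          (.of_forall hu1)
      have hbound : ‖∫ x, w x * u (charEval χ x) ∂μ‖ ≤ ε := by
        have h1 := integral_mul_charEval_eq_zero hc hadd hF h0 u
        have h2 : ∫ x, (F x - w x) * u (charEval χ x) ∂μ = - ∫ x, w x * u (charEval χ x) ∂μ := by
          simp_rw [sub_mul]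
          rw [integral_sub (hint F hF) (hint w hwi), h1, zero_sub]
        rw [← norm_neg, ← h2]
        refine (norm_integral_le_integral_norm _).trans (le_trans ?_ hFw)
        refine integral_mono (hint _ hFw_int).norm hFw_int.norm fun x => ?_
        simp only [norm_mul]
        exact mul_le_of_le_one_right (norm_nonneg _) (hu1 x)
      -- On `K` this is `|w| - |w|²/(|w| + δ) ≤ δ`.
      have hpt : ∀ x, ‖w x‖ ≤ (w x * u (charEval χ x)).re + K.indicator (fun _ => δ) x := by
        intro x
        by_cases hx : x ∈ K
        · rw [huK x hx, Set.indicator_of_mem hx, mul_div_assoc', Complex.mul_conj,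
            Complex.normSq_eq_norm_sq, ← Complex.ofReal_div, Complex.ofReal_re]
          have : ‖w x‖ = ‖w x‖ ^ 2 / (‖w x‖ + δ) + ‖w x‖ / (‖w x‖ + δ) * δ := by
            have := (hpos x).ne'
            field_simp
          have h2 : ‖w x‖ / (‖w x‖ + δ) * δ ≤ 1 * δ := by
            gcongr
            rw [div_le_one (hpos x)]
            linarith
          linarith
        · rw [image_eq_zero_of_notMem_tsupport hx, Set.indicator_of_notMem hx]
          simp
      have hind : Integrable (K.indicator fun _ => δ) μ :=
        (integrable_indicator_iff hKm).2 (integrableOn_const hKfin)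
      calc ∫ x, ‖w x‖ ∂μ ≤ ∫ x, ((w x * u (charEval χ x)).re + K.indicator (fun _ => δ) x) ∂μ :=
            integral_mono hwi.norm ((hint w hwi).re.add hind) hpt
        _ = (∫ x, w x * u (charEval χ x) ∂μ).re + δ * μ.real K := by
            have hre : ∫ x, (w x * u (charEval χ x)).re ∂μ =
                (∫ x, w x * u (charEval χ x) ∂μ).re := integral_re (hint w hwi)
            rw [← hre, mul_comm, ← smul_eq_mul, ← integral_indicator_const _ hKm]
            exact integral_add (hint w hwi).re hind
        _ ≤ ε + δ * μ.real K := by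
            gcongr
            exact (Complex.re_le_norm _).trans hbound
    have hw2 : ∫ x, ‖w x‖ ∂μ ≤ ε := by
      refine le_of_forall_pos_le_add fun η hη => ?_
      refine (hwε (η / (μ.real K + 1)) (by positivity)).trans ?_
      gcongr
      have h0 : 0 ≤ μ.real K := measureReal_nonneg
      rw [div_mul_eq_mul_div, div_le_iff₀ (by positivity)]
      nlinarith
    calc ∫ x, ‖F x‖ ∂μ ≤ ∫ x, (‖F x - w x‖ + ‖w x‖) ∂μ :=
          integral_mono hF.norm (hFw_int.norm.add hwi.norm) fun x => norm_le_norm_sub_add _ _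
      _ ≤ 2 * ε := by
          rw [integral_add hFw_int.norm hwi.norm]
          linarith
  have hle : ∫ x, ‖F x‖ ∂μ ≤ 0 := le_of_forall_pos_le_add fun η hη => by
    have := key (η / 2) (by positivity)
    linarith
  have heq := le_antisymm hle (integral_nonneg fun x => norm_nonneg _)
  rw [integral_eq_zero_iff_of_nonneg (fun x => norm_nonneg _) hF.norm] at heq
  filter_upwards [heq] with x hx
  exact norm_eq_zero.1 hx

end FourierUniqueness

/-! ### Absolutely convergent series of integrable functions -/

section SumIntegral

variable {α ι E : Type*} [MeasurableSpace α] {μ : Measure α} [Countable ι]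
  [NormedAddCommGroup E]

theorem tsum_lintegral_enorm_ne_top {F : ι → α → E} (hF : ∀ i, Integrable (F i) μ)
    (hs : Summable fun i => ∫ x, ‖F i x‖ ∂μ) : ∑' i, ∫⁻ x, ‖F i x‖ₑ ∂μ ≠ ∞ := by
  simp_rw [← ofReal_integral_norm_eq_lintegral_enorm (hF _)]
  rw [← ENNReal.ofReal_tsum_of_nonneg (fun i => integral_nonneg fun x => norm_nonneg _) hs]
  exact ENNReal.ofReal_ne_top

theorem lintegral_tsum_enorm_ne_top {F : ι → α → E} (hF : ∀ i, Integrable (F i) μ)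
    (hs : Summable fun i => ∫ x, ‖F i x‖ ∂μ) : ∫⁻ x, ∑' i, ‖F i x‖ₑ ∂μ ≠ ∞ := by
  rw [lintegral_tsum fun i => (hF i).1.enorm]
  exact tsum_lintegral_enorm_ne_top hF hs

theorem ae_summable_norm {F : ι → α → E} (hF : ∀ i, Integrable (F i) μ)
    (hs : Summable fun i => ∫ x, ‖F i x‖ ∂μ) : ∀ᵐ x ∂μ, Summable fun i => ‖F i x‖ := by
  have h := ae_lt_top' (AEMeasurable.tsum fun i => (hF i).1.enorm)
    (lintegral_tsum_enorm_ne_top hF hs)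
  filter_upwards [h] with x hx
  have h1 : ∑' i, ((‖F i x‖₊ : NNReal) : ℝ≥0∞) ≠ ∞ := hx.ne
  rw [ENNReal.tsum_coe_ne_top_iff_summable, ← NNReal.summable_coe] at h1
  exact h1

theorem integrable_of_hasSum {F : ι → α → E} {f : α → E} (hF : ∀ i, Integrable (F i) μ)
    (hs : Summable fun i => ∫ x, ‖F i x‖ ∂μ)
    (hf : ∀ᵐ x ∂μ, HasSum (fun i => F i x) (f x)) : Integrable f μ := by
  refine ⟨aestronglyMeasurable_of_tendsto_ae (f := fun (s : Finset ι) x => ∑ i ∈ s, F i x)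
    Filter.atTop (fun s => ?_) hf, ?_⟩
  · exact Finset.aestronglyMeasurable_fun_sum s fun i _ => (hF i).1
  · refine lt_of_le_of_lt (lintegral_mono_ae ?_) (lintegral_tsum_enorm_ne_top hF hs).lt_top
    filter_upwards [hf] with x hx
    rw [← hx.tsum_eq]
    exact enorm_tsum_le_tsum_enorm

theorem hasSum_integral_of_hasSum [NormedSpace ℝ E] {F : ι → α → E} {f : α → E}
    (hF : ∀ i, Integrable (F i) μ) (hs : Summable fun i => ∫ x, ‖F i x‖ ∂μ)
    (hf : ∀ᵐ x ∂μ, HasSum (fun i => F i x) (f x)) :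
    HasSum (fun i => ∫ x, F i x ∂μ) (∫ x, f x ∂μ) := by
  have h := hasSum_integral_of_summable_integral_norm hF hs
  rwa [integral_congr_ae (g := f) (hf.mono fun x hx => hx.tsum_eq)] at h

end SumIntegral

/-! ### Convolution in `L¹` -/

section Convolution

variable {Ξ : Type*} [AddCommGroup Ξ] [TopologicalSpace Ξ] [IsTopologicalAddGroup Ξ] [T2Space Ξ]
  [LocallyCompactSpace Ξ] [MeasurableSpace Ξ] [BorelSpace Ξ]
  {μ : Measure Ξ}

/-- Every integrable function is the sum of an absolutely convergent series in `L¹` of compactly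
supported continuous functions, which converges almost everywhere. -/
theorem exists_hasSum_continuous [μ.Regular] {f : Ξ → ℂ} (hf : Integrable f μ) :
    ∃ φ : ℕ → Ξ → ℂ, (∀ n, Continuous (φ n)) ∧ (∀ n, HasCompactSupport (φ n)) ∧
      (∀ n, Integrable (φ n) μ) ∧ (Summable fun n => ∫ x, ‖φ n x‖ ∂μ) ∧
      ∀ᵐ x ∂μ, HasSum (fun n => φ n x) (f x) := by
  have h : ∀ n : ℕ, ∃ g : Ξ → ℂ, HasCompactSupport g ∧ (∫ x, ‖f x - g x‖ ∂μ) ≤ (1 / 2) ^ n ∧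
      Continuous g ∧ Integrable g μ := fun n =>
    exists_continuous_integral_sub_le hf (by positivity)
  choose g hgs hg hgc hgi using h
  have hsub : ∀ n, Integrable (fun x => f x - g n x) μ := fun n => hf.sub (hgi n)
  have hsg : Summable fun n => ∫ x, ‖f x - g n x‖ ∂μ :=
    Summable.of_nonneg_of_le (fun n => integral_nonneg fun x => norm_nonneg _) hg
      summable_geometric_two
  have hlim : ∀ᵐ x ∂μ, Filter.Tendsto (fun n => g n x) Filter.atTop (nhds (f x)) := by
    filter_upwards [ae_summable_norm hsub hsg] with x hx
    have h1 := hx.tendsto_atTop_zero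
    rw [tendsto_iff_norm_sub_tendsto_zero]
    simpa only [norm_sub_rev] using h1
  -- Differences of successive approximations, so that the partial sums up to index `n` telescope to
  -- `g n`.
  let φ : ℕ → Ξ → ℂ := fun n => Nat.casesOn n (g 0) fun k => g (k + 1) - g k
  have hφi : ∀ n, Integrable (φ n) μ := fun n => by
    cases n with
    | zero => exact hgi 0
    | succ k => exact (hgi (k + 1)).sub (hgi k)
  have hφsum : Summable fun n => ∫ x, ‖φ n x‖ ∂μ := by
    rw [← summable_nat_add_iff 1]
    refine Summable.of_nonneg_of_le (fun n => integral_nonneg fun x => norm_nonneg _) (fun n => ?_)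
      (((summable_nat_add_iff 1).2 hsg).add hsg)
    rw [← integral_add (hsub (n + 1)).norm (hsub n).norm]
    refine integral_mono (hφi (n + 1)).norm
      ((hsub (n + 1)).norm.add (hsub n).norm) fun x => ?_
    change ‖g (n + 1) x - g n x‖ ≤ ‖f x - g (n + 1) x‖ + ‖f x - g n x‖
    rw [norm_sub_rev (f x) (g (n + 1) x)]
    exact norm_sub_le_norm_sub_add_norm_sub _ _ _
  have hpart : ∀ n x, ∑ k ∈ Finset.range (n + 1), φ k x = g n x := fun n x => by
    induction n with
    | zero => simp [φ]
    | succ n ih =>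
      rw [Finset.sum_range_succ, ih]
      change g n x + (g (n + 1) x - g n x) = _
      ring
  refine ⟨φ, fun n => ?_, fun n => ?_, hφi, hφsum, ?_⟩
  · cases n with
    | zero => exact hgc 0
    | succ k => exact (hgc (k + 1)).sub (hgc k)
  · cases n with
    | zero => exact hgs 0
    | succ k => exact (hgs (k + 1)).sub (hgs k)
  · filter_upwards [hlim, ae_summable_norm hφi hφsum] with x hx hx2
    have h1 := hx2.of_norm.hasSum
    have h2 := (Filter.tendsto_add_atTop_iff_nat 1).2 h1.tendsto_sum_nat
    simp_rw [hpart] at h2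
    rwa [tendsto_nhds_unique h2 hx] at h1

variable [μ.IsAddHaarMeasure]

/-- Fubini is applied to a compactly supported continuous integrand, where it holds without
σ-finiteness. Besides multiplicativity of characters it yields, for `χ = 1` and absolute values over
`ℝ`, the norm bound for convolutions. -/
theorem integral_integral_mul_sub_mul_char {𝕜 : Type*} [RCLike 𝕜] {f g χ : Ξ → 𝕜}
    (hf : Continuous f) (hfs : HasCompactSupport f) (hg : Continuous g)
    (hgs : HasCompactSupport g) (hχ : Continuous χ) (hadd : ∀ x y, χ (x + y) = χ x * χ y) :
    ∫ y, (∫ t, f t * g (y - t) ∂μ) * χ y ∂μ = (∫ x, f x * χ x ∂μ) * ∫ x, g x * χ x ∂μ := by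
  simp_rw [← integral_mul_const]
  have hcont : Continuous (Function.uncurry fun y t => f t * g (y - t) * χ y) := by
    unfold Function.uncurry
    fun_prop
  rw [integral_integral_swap_of_hasCompactSupport hcont]
  · refine integral_congr_ae (.of_forall fun t => ?_)
    simp only
    rw [← integral_add_right_eq_self _ t, ← integral_const_mul]
    refine integral_congr_ae (.of_forall fun y => ?_)
    simp only [add_sub_cancel_right, hadd]
    ring
  · refine HasCompactSupport.intro
      (K := (fun p : Ξ × Ξ => (p.2 + p.1, p.1)) '' (tsupport f ×ˢ tsupport g))
      ((hfs.isCompact.prod hgs.isCompact).image (by fun_prop)) fun p hp => ?_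
    by_contra h
    apply hp
    have h1 : f p.2 * g (p.1 - p.2) * χ p.1 ≠ 0 := h
    refine ⟨(p.2, p.1 - p.2), ⟨subset_tsupport f ?_, subset_tsupport g ?_⟩, by simp⟩
    · exact left_ne_zero_of_mul (left_ne_zero_of_mul h1)
    · exact right_ne_zero_of_mul (left_ne_zero_of_mul h1)

theorem integrable_mul_sub {𝕜 : Type*} [RCLike 𝕜] {f g : Ξ → 𝕜}
    (hf : Continuous f) (hfs : HasCompactSupport f) (hg : Continuous g) (y : Ξ) :
    Integrable (fun t => f t * g (y - t)) μ :=
  (hf.mul (hg.comp (continuous_sub_left y))).integrable_of_hasCompactSupport hfs.mul_right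

theorem integrable_integral_mul_sub {𝕜 : Type*} [RCLike 𝕜] {f g : Ξ → 𝕜}
    (hf : Continuous f) (hfs : HasCompactSupport f) (hg : Continuous g)
    (hgs : HasCompactSupport g) : Integrable (fun y => ∫ t, f t * g (y - t) ∂μ) μ :=
  (hgs.continuous_convolution_right (ContinuousLinearMap.mul ℝ 𝕜)
    (hf.integrable_of_hasCompactSupport hfs).locallyIntegrable hg).integrable_of_hasCompactSupport
    (hfs.convolution (ContinuousLinearMap.mul ℝ 𝕜) hgs)

variable [μ.Regular]

theorem hasSum_integral_mul_char {u : Ξ → ℂ} {ρ : ℕ → Ξ → ℂ} (hi : ∀ n, Integrable (ρ n) μ)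
    (hs : Summable fun n => ∫ x, ‖ρ n x‖ ∂μ) (hu : ∀ᵐ x ∂μ, HasSum (fun n => ρ n x) (u x))
    {χ : Ξ → Circle} (hχ : Continuous χ) :
    HasSum (fun n => ∫ x, ρ n x * χ x ∂μ) (∫ x, u x * χ x ∂μ) ∧
      Summable fun n => ‖∫ x, ρ n x * χ x ∂μ‖ := by
  have hs' : Summable fun n => ∫ x, ‖ρ n x * χ x‖ ∂μ := by
    simpa only [norm_mul, Circle.norm_coe, mul_one] using hs
  exact ⟨hasSum_integral_of_hasSum (fun n => integrable_circle_mul (hi n) hχ) hs'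
    (hu.mono fun y hy => hy.mul_right _),
    Summable.of_nonneg_of_le (fun _ => norm_nonneg _)
      (fun n => norm_integral_le_integral_norm _) hs'⟩

theorem hasSum_mul_of_summable_norm {u v : ℕ → ℂ} {a b : ℂ} (hu : HasSum u a) (hv : HasSum v b)
    (hu' : Summable fun n => ‖u n‖) (hv' : Summable fun n => ‖v n‖) :
    HasSum (fun p : ℕ × ℕ => u p.1 * v p.2) (a * b) :=
  hu.mul hv (summable_mul_of_summable_norm hu' hv')

theorem ae_hasSum_mul_sub {f g : Ξ → ℂ} {φ ψ : ℕ → Ξ → ℂ}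
    (hφ : ∀ᵐ x ∂μ, Summable fun n => ‖φ n x‖) (hφf : ∀ᵐ x ∂μ, HasSum (fun n => φ n x) (f x))
    (hψ : ∀ᵐ x ∂μ, Summable fun n => ‖ψ n x‖) (hψg : ∀ᵐ x ∂μ, HasSum (fun n => ψ n x) (g x))
    (y : Ξ) :
    ∀ᵐ t ∂μ, HasSum (fun p : ℕ × ℕ => φ p.1 t * ψ p.2 (y - t)) (f t * g (y - t)) := by
  have hqmp := (Measure.measurePreserving_sub_left μ y).quasiMeasurePreserving
  filter_upwards [hφ, hφf, hqmp.ae hψ, hqmp.ae hψg] with t h1 h2 h3 h4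
  exact hasSum_mul_of_summable_norm (u := fun n => φ n t) (v := fun n => ψ n (y - t)) h2 h4 h1 h3

theorem convolution_mul_apply (f g : Ξ → ℂ) (y : Ξ) :
    (f ⋆[ContinuousLinearMap.mul ℂ ℂ, μ] g) y = ∫ t, f t * g (y - t) ∂μ := by
  simp only [convolution_def, ContinuousLinearMap.mul_apply']

theorem convolutionExistsAt_mul {f g : Ξ → ℂ} {y : Ξ}
    (h : Integrable (fun t => f t * g (y - t)) μ) :
    ConvolutionExistsAt f g y (ContinuousLinearMap.mul ℂ ℂ) μ := by
  simpa only [ConvolutionExistsAt, ContinuousLinearMap.mul_apply'] using h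

/-- The convolution of integrable functions exists almost everywhere, is integrable, and
characters are multiplicative with respect to it. -/
theorem convolution_integrable {f g : Ξ → ℂ} (hf : Integrable f μ) (hg : Integrable g μ) :
    (∀ᵐ y ∂μ, ConvolutionExistsAt f g y (ContinuousLinearMap.mul ℂ ℂ) μ) ∧
    Integrable (f ⋆[ContinuousLinearMap.mul ℂ ℂ, μ] g) μ ∧
    ∀ χ : Ξ → Circle, Continuous χ → (∀ x y, χ (x + y) = χ x * χ y) →
      ∫ y, (f ⋆[ContinuousLinearMap.mul ℂ ℂ, μ] g) y * χ y ∂μ =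
        (∫ x, f x * χ x ∂μ) * ∫ x, g x * χ x ∂μ := by
  obtain ⟨φ, hφc, hφs, hφi, hφ, hφf⟩ := exists_hasSum_continuous hf
  obtain ⟨ψ, hψc, hψs, hψi, hψ, hψg⟩ := exists_hasSum_continuous hg
  have hφ1 := ae_summable_norm hφi hφ
  have hψ1 := ae_summable_norm hψi hψ
  -- The convolutions of absolute values majorize the double series. Their `L¹` norms are summable,
  -- so for almost every `y` the series can be integrated in `t` term by term.
  let h : ℕ × ℕ → Ξ → ℝ := fun p y => ∫ t, ‖φ p.1 t‖ * ‖ψ p.2 (y - t)‖ ∂μ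
  have hh0 : ∀ p y, 0 ≤ h p y := fun p y => integral_nonneg fun t => by positivity
  have hhi : ∀ p, Integrable (h p) μ := fun p =>
    integrable_integral_mul_sub (hφc p.1).norm (hφs p.1).norm (hψc p.2).norm (hψs p.2).norm
  have hhs : Summable fun p => ∫ y, ‖h p y‖ ∂μ := by
    have e : ∀ p, ∫ y, ‖h p y‖ ∂μ = (∫ x, ‖φ p.1 x‖ ∂μ) * ∫ x, ‖ψ p.2 x‖ ∂μ := fun p => by
      simp_rw [Real.norm_of_nonneg (hh0 p _)]
      have := integral_integral_mul_sub_mul_char (μ := μ) (χ := fun _ => (1 : ℝ))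
        (hφc p.1).norm (hφs p.1).norm (hψc p.2).norm (hψs p.2).norm continuous_const (by simp)
      simpa only [mul_one] using this
    simp_rw [e]
    exact hφ.mul_of_nonneg hψ (fun n => integral_nonneg fun x => norm_nonneg _)
      fun n => integral_nonneg fun x => norm_nonneg _
  let F : ℕ × ℕ → Ξ → ℂ := fun p y => ∫ t, φ p.1 t * ψ p.2 (y - t) ∂μ
  have hFi : ∀ p, Integrable (F p) μ := fun p =>
    integrable_integral_mul_sub (hφc p.1) (hφs p.1) (hψc p.2) (hψs p.2)
  have hFh : ∀ p y, ‖F p y‖ ≤ h p y := fun p y => by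
    refine (norm_integral_le_integral_norm _).trans (le_of_eq ?_)
    simp_rw [norm_mul]
    rfl
  have hFs : Summable fun p => ∫ y, ‖F p y‖ ∂μ :=
    Summable.of_nonneg_of_le (fun p => integral_nonneg fun x => norm_nonneg _)
      (fun p => integral_mono (hFi p).norm (hhi p).norm fun y =>
        (hFh p y).trans (le_abs_self _)) hhs
  have key : ∀ᵐ y ∂μ, Integrable (fun t => f t * g (y - t)) μ ∧
      HasSum (fun p => F p y) (∫ t, f t * g (y - t) ∂μ) := by
    filter_upwards [ae_summable_norm hhi hhs] with y hy
    have hsum := ae_hasSum_mul_sub hφ1 hφf hψ1 hψg y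
    have hi : ∀ p : ℕ × ℕ, Integrable (fun t => φ p.1 t * ψ p.2 (y - t)) μ := fun p =>
      integrable_mul_sub (hφc p.1) (hφs p.1) (hψc p.2) y
    have hs : Summable fun p : ℕ × ℕ => ∫ t, ‖φ p.1 t * ψ p.2 (y - t)‖ ∂μ := by
      simp_rw [Real.norm_of_nonneg (hh0 _ y)] at hy
      simp_rw [norm_mul]
      exact hy
    exact ⟨integrable_of_hasSum hi hs hsum, hasSum_integral_of_hasSum hi hs hsum⟩
  have hconv : ∀ᵐ y ∂μ, HasSum (fun p => F p y) ((f ⋆[ContinuousLinearMap.mul ℂ ℂ, μ] g) y) :=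
    key.mono fun y hy => by rw [convolution_mul_apply]; exact hy.2
  have hc1 := integrable_of_hasSum hFi hFs hconv
  have hc2 := key.mono fun y hy => convolutionExistsAt_mul hy.1
  refine ⟨hc2, hc1, fun χ hχ hadd => ?_⟩
  have hχ' : Continuous fun x => (χ x : ℂ) := continuous_subtype_val.comp hχ
  have hl : HasSum (fun p => ∫ y, F p y * χ y ∂μ)
      (∫ y, (f ⋆[ContinuousLinearMap.mul ℂ ℂ, μ] g) y * χ y ∂μ) := by
    refine hasSum_integral_of_hasSum (F := fun p y => F p y * χ y)
      (f := fun y => (f ⋆[ContinuousLinearMap.mul ℂ ℂ, μ] g) y * χ y)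
      (fun p => integrable_circle_mul (hFi p) hχ) ?_ (hconv.mono fun y hy => hy.mul_right _)
    simpa only [norm_mul, Circle.norm_coe, mul_one] using hFs
  obtain ⟨a1, a2⟩ := hasSum_integral_mul_char hφi hφ hφf hχ
  obtain ⟨b1, b2⟩ := hasSum_integral_mul_char hψi hψ hψg hχ
  have hr := hasSum_mul_of_summable_norm (u := fun n => ∫ x, φ n x * χ x ∂μ)
    (v := fun n => ∫ x, ψ n x * χ x ∂μ) a1 b1 a2 b2
  have e : (fun p => ∫ y, F p y * χ y ∂μ) =
      fun p : ℕ × ℕ => (∫ x, φ p.1 x * χ x ∂μ) * ∫ x, ψ p.2 x * χ x ∂μ := funext fun p =>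
    integral_integral_mul_sub_mul_char (χ := fun x => (χ x : ℂ)) (hφc p.1) (hφs p.1) (hψc p.2)
      (hψs p.2) hχ' fun x y => by rw [hadd, Circle.coe_mul]
  rw [e] at hl
  exact hl.unique hr

end Convolution

/-! ### The symplectic characters -/

section Symplectic

variable {Ξ : Type*} [AddCommGroup Ξ] [TopologicalSpace Ξ] {m : Ξ → Ξ → Circle}

/-- The commutation bicharacter `σ(y, x) = m(y, x) / m(x, y)`. -/
def symp (m : Ξ → Ξ → Circle) (y x : Ξ) : Circle := m y x / m x y

namespace IsHeisenbergMultiplier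

theorem continuous_symp (hm : IsHeisenbergMultiplier m) (y : Ξ) : Continuous (symp m y) :=
  (hm.continuous_right y).div' (hm.continuous_left y)

theorem symp_add_left (hm : IsHeisenbergMultiplier m) (y y' x : Ξ) :
    symp m (y + y') x = symp m y x * symp m y' x := by
  obtain ⟨e, he⟩ := hm.duality
  unfold symp
  rw [← he, ← he, ← he, ofAdd_add, map_mul]
  rfl

theorem symp_add_right (hm : IsHeisenbergMultiplier m) (y x x' : Ξ) :
    symp m y (x + x') = symp m y x * symp m y x' := by
  obtain ⟨e, he⟩ := hm.duality
  unfold symp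
  rw [← he, ← he, ← he, ofAdd_add, map_mul]

theorem eq_of_symp_eq (hm : IsHeisenbergMultiplier m) (x x' : Ξ)
    (h : ∀ y, symp m y x = symp m y x') : x = x' := by
  obtain ⟨e, he⟩ := hm.duality
  have h1 : e (Multiplicative.ofAdd x) = e (Multiplicative.ofAdd x') := by
    ext y
    have h2 := h y.toAdd
    have h3 := he x y.toAdd
    have h4 := he x' y.toAdd
    rw [ofAdd_toAdd] at h3 h4
    rw [h3, h4]
    unfold symp at h2
    rw [← inv_div (m y.toAdd x), ← inv_div (m y.toAdd x'), h2]
  exact Multiplicative.ofAdd.injective (e.injective h1)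

end IsHeisenbergMultiplier

variable {H : Type*} [NormedAddCommGroup H] [InnerProductSpace ℂ H] [CompleteSpace H]
  {U : Ξ → unitary (H →L[ℂ] H)}

/-- The commutation relation of `U_x` and `U_y`: multiplying a coefficient by a symplectic character
gives again a coefficient, with both vectors moved by `U_y*`. -/
theorem IsIrreducibleProjRep.symp_mul_inner (hU : IsIrreducibleProjRep m U) (a b : H) (x y : Ξ) :
    ⟪a, (U x : H →L[ℂ] H) b⟫_ℂ * symp m y x =
      ⟪star (U y : H →L[ℂ] H) a, (U x : H →L[ℂ] H) (star (U y : H →L[ℂ] H) b)⟫_ℂ := by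
  rw [inner_star_unitary_apply, hU.apply_comm, unitary_apply_star_apply, inner_smul_right,
    mul_comm]
  rfl

end Symplectic

/-! ### Existence of the reflection operator -/

section Reflection

variable {Ξ : Type*} [AddCommGroup Ξ] [TopologicalSpace Ξ] [IsTopologicalAddGroup Ξ]
  [MeasurableSpace Ξ] [BorelSpace Ξ]
  {μ : Measure Ξ}
  {H : Type*} [NormedAddCommGroup H] [InnerProductSpace ℂ H] [CompleteSpace H]
  {m : Ξ → Ξ → Circle} {U : Ξ → unitary (H →L[ℂ] H)}

/-- This is where the symmetry of `m` enters: it lets `U_x` and `U_{-x}` be compared as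
representations with the same multiplier. -/
theorem IsIrreducibleProjRep.neg (hU : IsIrreducibleProjRep m U)
    (hsymm : ∀ x y, m x y = m (-x) (-y)) : IsIrreducibleProjRep m fun x => U (-x) where
  mul x y := by rw [hU.mul, ← hsymm, neg_add]
  continuous φ := (hU.continuous φ).comp continuous_neg
  nontrivial := hU.nontrivial
  irreducible K hK h := hU.irreducible K hK fun x φ hφ => by
    have := h (-x) φ hφ
    rwa [neg_neg] at this

theorem inner_toLp_toLp {f g : Ξ → ℂ} (hf : MemLp f 2 μ) (hg : MemLp g 2 μ) :
    ⟪hf.toLp f, hg.toLp g⟫_ℂ = ∫ x, (starRingEnd ℂ) (f x) * g x ∂μ := by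
  rw [MeasureTheory.L2.inner_def]
  refine integral_congr_ae ?_
  filter_upwards [hf.coeFn_toLp, hg.coeFn_toLp] with x h1 h2
  rw [h1, h2, RCLike.inner_apply']

theorem norm_toLp_sq {f : Ξ → ℂ} (hf : MemLp f 2 μ) : ‖hf.toLp f‖ ^ 2 = ∫ x, ‖f x‖ ^ 2 ∂μ := by
  have h := inner_toLp_toLp hf hf
  rw [← integral_norm_sq_eq_re, inner_self_eq_ofReal] at h
  exact Complex.ofReal_injective h

/-- The operator `a ↦ ⟨U_x φ, a⟩` from `H` to `L²`. -/
def coeffL2 {φ : H} (h : ∀ a, MemLp (coeff U φ a) 2 μ) {C : ℝ}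
    (hC : ∀ a, ∫ x, ‖coeff U φ a x‖ ^ 2 ∂μ = C * ‖a‖ ^ 2) : H →L[ℂ] Lp ℂ 2 μ :=
  LinearMap.mkContinuous
    { toFun := fun a => (h a).toLp
      map_add' := fun a b => by
        rw [← MemLp.toLp_add]
        congr 1
        funext x
        exact inner_add_right _ _ _
      map_smul' := fun c a => by
        rw [RingHom.id_apply, ← MemLp.toLp_const_smul]
        congr 1
        funext x
        exact inner_smul_right _ _ _ } √C fun a => by
    change ‖(h a).toLp‖ ≤ _
    rw [← Real.sqrt_sq (norm_nonneg ((h a).toLp)), norm_toLp_sq, hC,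
      Real.sqrt_mul' _ (sq_nonneg _), Real.sqrt_sq (norm_nonneg _)]

/-- Two representations with the same multiplier and with square integrable coefficients are
intertwined by the operators `∫ U_x |φ⟩⟨ψ| V_x* dx`. -/
theorem exists_intertwiner [μ.IsAddHaarMeasure] (hU : IsIrreducibleProjRep m U)
    {V : Ξ → unitary (H →L[ℂ] H)} (hV : IsIrreducibleProjRep m V) {φ ψ : H} {C D : ℝ}
    (h : ∀ a, MemLp (coeff U φ a) 2 μ ∧ ∫ x, ‖coeff U φ a x‖ ^ 2 ∂μ = C * ‖a‖ ^ 2)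
    (h' : ∀ a, MemLp (coeff V ψ a) 2 μ ∧ ∫ x, ‖coeff V ψ a x‖ ^ 2 ∂μ = D * ‖a‖ ^ 2) :
    ∃ T : H →L[ℂ] H,
      (∀ a b, ⟪a, T b⟫_ℂ = ∫ x, (starRingEnd ℂ) (coeff U φ a x) * coeff V ψ b x ∂μ) ∧
      ∀ y, (U y : H →L[ℂ] H) * T = T * V y := by
  let S := coeffL2 (fun a => (h a).1) fun a => (h a).2
  let S' := coeffL2 (fun a => (h' a).1) fun a => (h' a).2
  have hT : ∀ a b, ⟪a, (ContinuousLinearMap.adjoint S ∘L S') b⟫_ℂ =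
      ∫ x, (starRingEnd ℂ) (coeff U φ a x) * coeff V ψ b x ∂μ := fun a b => by
    change ⟪a, ContinuousLinearMap.adjoint S (S' b)⟫_ℂ = _
    rw [ContinuousLinearMap.adjoint_inner_right]
    exact inner_toLp_toLp (h a).1 (h' b).1
  refine ⟨ContinuousLinearMap.adjoint S ∘L S', hT, fun y => ?_⟩
  ext b
  refine ext_inner_left ℂ fun a => ?_
  rw [mul_apply_eq_comp, mul_apply_eq_comp, ← inner_star_unitary_apply, hT, hT,
    ← hU.integral_coeff_apply hV _ _ _ _ y, unitary_apply_star_apply]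

/-- Operators intertwining two irreducible representations are multiples of unitaries. -/
theorem exists_unitary_intertwiner (hU : IsIrreducibleProjRep m U)
    {V : Ξ → unitary (H →L[ℂ] H)} (hV : IsIrreducibleProjRep m V) {T : H →L[ℂ] H} (hT0 : T ≠ 0)
    (hT : ∀ y, (U y : H →L[ℂ] H) * T = T * V y) :
    ∃ R : unitary (H →L[ℂ] H), ∀ y, U y * R = R * V y := by
  have hT' : ∀ y, (V y : H →L[ℂ] H) * star T = star T * U y := fun y => by
    have h1 := congrArg (fun X => (V y : H →L[ℂ] H) * star X * U y) (hT y)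
    simp only [star_mul] at h1
    have e1 : (U y : H →L[ℂ] H) * star (U y : H →L[ℂ] H) = 1 := Unitary.coe_mul_star_self (U y)
    have e2 : star (U y : H →L[ℂ] H) * (U y : H →L[ℂ] H) = 1 := Unitary.coe_star_mul_self (U y)
    have e3 : (V y : H →L[ℂ] H) * star (V y : H →L[ℂ] H) = 1 := Unitary.coe_mul_star_self (V y)
    rw [mul_assoc, mul_assoc, e2, mul_one, ← mul_assoc, e3, one_mul] at h1
    exact h1
  obtain ⟨c, hc⟩ := hV.eq_smul_one_of_isSelfAdjoint (IsSelfAdjoint.star_mul_self T) fun y => by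
    rw [Commute, SemiconjBy, mul_assoc, ← hT, ← mul_assoc, ← hT', mul_assoc]
  obtain ⟨c', hc'⟩ := hU.eq_smul_one_of_isSelfAdjoint (IsSelfAdjoint.mul_star_self T) fun y => by
    rw [Commute, SemiconjBy, mul_assoc, ← hT', ← mul_assoc, ← hT, mul_assoc]
  have hn : ∀ x, ‖T x‖ ^ 2 = c * ‖x‖ ^ 2 := fun x => by
    have h1 : ⟪x, (star T * T) x⟫_ℂ = ⟪T x, T x⟫_ℂ := by
      rw [mul_apply_eq_comp, ContinuousLinearMap.star_eq_adjoint,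
        ContinuousLinearMap.adjoint_inner_right]
    rw [hc, smul_apply, one_apply_eq_self, inner_smul_right, inner_self_eq_ofReal,
      inner_self_eq_ofReal] at h1
    exact_mod_cast h1.symm
  obtain ⟨x, hx⟩ : ∃ x, T x ≠ 0 := by
    by_contra h
    push Not at h
    exact hT0 (ContinuousLinearMap.ext h)
  have hcpos : 0 < c := by
    have h1 := hn x
    have h2 : 0 < ‖T x‖ ^ 2 := by positivity
    rw [h1] at h2
    exact pos_of_mul_pos_left h2 (sq_nonneg _)
  -- Both `T*T = c` and `TT* = c'` are scalars; evaluating `T T* T` in two ways identifies them, and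
  -- `T/√c` is unitary.
  have hcc : c' = c := by
    have h1 : T * (star T * T) = (T * star T) * T := (mul_assoc _ _ _).symm
    rw [hc, hc', mul_smul_comm, mul_one, smul_mul_assoc, one_mul] at h1
    have h2 := DFunLike.congr_fun h1 x
    simp only [smul_apply] at h2
    exact_mod_cast (smul_left_injective ℂ hx h2).symm
  have hs : (((√c)⁻¹ : ℝ) : ℂ) * (((√c)⁻¹ : ℝ) : ℂ) * c = 1 := by
    rw [← Complex.ofReal_mul, ← Complex.ofReal_mul, ← mul_inv, Real.mul_self_sqrt hcpos.le,
      inv_mul_cancel₀ hcpos.ne', Complex.ofReal_one]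
  refine ⟨⟨(((√c)⁻¹ : ℝ) : ℂ) • T, Unitary.mem_iff.2 ⟨?_, ?_⟩⟩, fun y => Subtype.ext ?_⟩
  · rw [star_smul, smul_mul_smul_comm, hc, smul_smul, RCLike.star_def, Complex.conj_ofReal, hs,
      one_smul]
  · rw [star_smul, smul_mul_smul_comm, hc', hcc, smul_smul, RCLike.star_def, Complex.conj_ofReal,
      hs, one_smul]
  · change (U y : H →L[ℂ] H) * ((((√c)⁻¹ : ℝ) : ℂ) • T) = ((((√c)⁻¹ : ℝ) : ℂ) • T) * V y
    rw [mul_smul_comm, hT, smul_mul_assoc]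

/-- If every average of rank one operators had zero matrix elements, varying the vectors by `U_y*`
would make all Fourier coefficients of a product of two coefficients vanish. That product is
continuous and nonzero at `0`. -/
theorem exists_isReflection [T2Space Ξ] [LocallyCompactSpace Ξ] [μ.IsAddHaarMeasure] [μ.Regular]
    (hm : IsHeisenbergMultiplier m) (hsymm : ∀ x y, m x y = m (-x) (-y))
    (hU : IsIrreducibleProjRep m U) (hsq : IsSquareIntegrable μ U) :
    ∃ R : unitary (H →L[ℂ] H), IsReflection U R := by
  have hV := hU.neg hsymm
  obtain ⟨k, -, hk, -⟩ := hU.exists_orthogonality hsq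
  have hk' : ∀ φ a, MemLp (coeff (fun x => U (-x)) φ a) 2 μ ∧
      ∫ x, ‖coeff (fun x => U (-x)) φ a x‖ ^ 2 ∂μ = k * ‖φ‖ ^ 2 * ‖a‖ ^ 2 := fun φ a =>
    ⟨(hk φ a).1.comp_measurePreserving (Measure.measurePreserving_neg μ),
      (integral_neg_eq_self (fun x => ‖coeff U φ a x‖ ^ 2) μ).trans (hk φ a).2⟩
  have := hU.nontrivial
  obtain ⟨v, hv⟩ := exists_ne (0 : H)
  suffices h : ∃ φ a, ∫ x, (starRingEnd ℂ) (coeff U φ a x) *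
      coeff (fun x => U (-x)) v ((U (-0) : H →L[ℂ] H) v) x ∂μ ≠ 0 by
    obtain ⟨φ, a, h⟩ := h
    obtain ⟨T, hT, hTU⟩ := exists_intertwiner hU hV (hk φ) (hk' v)
    refine exists_unitary_intertwiner hU hV (fun h0 => h ?_) hTU
    rw [← hT, h0]
    exact inner_zero_right _
  by_contra! h0
  set G := coeff (fun x => U (-x)) v ((U (-0) : H →L[ℂ] H) v) with hG
  have hcont : Continuous fun x => (starRingEnd ℂ) (coeff U v ((U 0 : H →L[ℂ] H) v) x) * G x :=
    (Complex.continuous_conj.comp (hU.continuous_coeff _ _)).mul (hV.continuous_coeff _ _)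
  have hint : Integrable
      (fun x => (starRingEnd ℂ) (coeff U v ((U 0 : H →L[ℂ] H) v) x) * G x) μ := by
    have h1 : MemLp (fun x => (starRingEnd ℂ) (coeff U v ((U 0 : H →L[ℂ] H) v) x)) 2 μ :=
      (memLp_congr_norm (Complex.continuous_conj.comp (hU.continuous_coeff _ _)).aestronglyMeasurable
        (hU.aestronglyMeasurable_coeff _ _) (.of_forall fun x => RCLike.norm_conj _)).2 (hk _ _).1
    exact h1.integrable_mul (hk' _ _).1
  have hz := ae_eq_zero_of_integral_mul_char_eq_zero hm.continuous_symp hm.symp_add_left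
    hm.eq_of_symp_eq hint fun y => by
      rw [← h0 (star (U y : H →L[ℂ] H) v) (star (U y : H →L[ℂ] H) ((U 0 : H →L[ℂ] H) v))]
      refine integral_congr_ae (.of_forall fun x => ?_)
      simp only [conj_coeff]
      rw [← hU.symp_mul_inner]
      ring
  have hz0 := congrFun ((Continuous.ae_eq_iff_eq μ hcont continuous_zero).1 hz) 0
  rw [Pi.zero_apply, hG, coeff, coeff, inner_unitary_unitary, inner_unitary_unitary,
    mul_eq_zero] at hz0
  rcases hz0 with h1 | h1
  · exact hv (inner_self_eq_zero.1 ((map_eq_zero _).1 h1))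
  · exact hv (inner_self_eq_zero.1 h1)

end Reflection

/-! ### Fourier transforms and the operator-operator convolution -/

section Transforms

variable {Ξ : Type*} [AddCommGroup Ξ] [TopologicalSpace Ξ] [MeasurableSpace Ξ]
  {μ : Measure Ξ}
  {H : Type*} [NormedAddCommGroup H] [InnerProductSpace ℂ H] [CompleteSpace H]
  {m : Ξ → Ξ → Circle} {U : Ξ → unitary (H →L[ℂ] H)} {R : unitary (H →L[ℂ] H)}

/-- The symplectic Fourier transform of a function. -/
def sympFourier (μ : Measure Ξ) (m : Ξ → Ξ → Circle) (f : Ξ → ℂ) (y : Ξ) : ℂ :=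
  ∫ x, f x * symp m y x ∂μ

/-- The Fourier-Weyl transform of an operator. -/
def weylFourier (U : Ξ → unitary (H →L[ℂ] H)) (A : H →L[ℂ] H) (y : Ξ) : ℂ :=
  trace (A * (U y : H →L[ℂ] H))

/-- The phase relating `U_{-y}*` and `U_y`. -/
def reflPhase (m : Ξ → Ξ → Circle) (y : Ξ) : Circle := (m (-y) y * m 0 0)⁻¹

theorem IsIrreducibleProjRep.star_neg_apply (hU : IsIrreducibleProjRep m U) (y : Ξ) (φ : H) :
    star (U (-y) : H →L[ℂ] H) φ = (reflPhase m y : ℂ) • (U y : H →L[ℂ] H) φ := by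
  rw [hU.star_apply, neg_neg]
  rfl

theorem IsReflection.apply_apply (hR : IsReflection U R) (x : Ξ) (φ : H) :
    (U x : H →L[ℂ] H) ((R : H →L[ℂ] H) φ) = (R : H →L[ℂ] H) ((U (-x) : H →L[ℂ] H) φ) :=
  DFunLike.congr_fun (congrArg Subtype.val (hR x)) φ

theorem shift_reflect (A : H →L[ℂ] H) (x : Ξ) :
    shift U x (reflect R A) = ((U x : H →L[ℂ] H) * R) * A * star ((U x : H →L[ℂ] H) * R) := by
  unfold shift reflect
  rw [star_mul]
  noncomm_ring

theorem NuclearExpansion.conj {A : H →L[ℂ] H} {a b : ℕ → H} (h : NuclearExpansion A a b)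
    (C : H →L[ℂ] H) :
    NuclearExpansion (C * A * star C) (fun n => C (a n)) fun n => C (b n) := by
  simpa only [star_star] using (h.mul_left C).mul_right (star C)

theorem opConvFun_rankOne (T : H →L[ℂ] H) (c d : H) (x : Ξ) :
    opConvFun U R T (InnerProductSpace.rankOne ℂ d c) x =
      ⟪(U x : H →L[ℂ] H) ((R : H →L[ℂ] H) c), T ((U x : H →L[ℂ] H) ((R : H →L[ℂ] H) d))⟫_ℂ := by
  unfold opConvFun
  rw [shift_reflect]
  have h : ((U x : H →L[ℂ] H) * R) * InnerProductSpace.rankOne ℂ d c *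
      star ((U x : H →L[ℂ] H) * R) = InnerProductSpace.rankOne ℂ
        ((U x : H →L[ℂ] H) ((R : H →L[ℂ] H) d)) ((U x : H →L[ℂ] H) ((R : H →L[ℂ] H) c)) := by
    ext v
    simp only [mul_apply_eq_comp, InnerProductSpace.rankOne_apply, map_smul, star_mul,
      inner_star_unitary_apply_right]
  rw [h, trace_mul_rankOne]

theorem weylFourier_rankOne (c d : H) (y : Ξ) :
    weylFourier U (InnerProductSpace.rankOne ℂ d c) y = ⟪c, (U y : H →L[ℂ] H) d⟫_ℂ := by
  have h := (nuclearExpansion_rankOne c d).hasSum_trace_mul (U y : H →L[ℂ] H)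
  refine h.unique ?_
  convert hasSum_single 0 fun n hn => ?_ using 1
  · simp
  · simp [hn]

theorem isTraceClass_opConv {A : H →L[ℂ] H} (hA : IsTraceClass A) (B : H →L[ℂ] H) (x : Ξ) :
    IsTraceClass (A * shift U x (reflect R B)) := hA.mul_right _

/-- Expanding both operators turns the trace into a double series of products of matrix
coefficients, absolutely summable for every `x`. -/
theorem hasSum_opConvFun {A B : H →L[ℂ] H} {a b c d : ℕ → H} (hA : NuclearExpansion A a b)
    (hB : NuclearExpansion B c d) (x : Ξ) :
    HasSum (fun p : ℕ × ℕ =>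
      ⟪a p.1, (U x : H →L[ℂ] H) ((R : H →L[ℂ] H) (d p.2))⟫_ℂ *
        ⟪(U x : H →L[ℂ] H) ((R : H →L[ℂ] H) (c p.2)), b p.1⟫_ℂ) (opConvFun U R A B x) := by
  have hsq : ∀ u v : ℕ → H, (Summable fun n => ‖u n‖ ^ 2) → (Summable fun n => ‖v n‖ ^ 2) →
      Summable fun p : ℕ × ℕ =>
        ‖⟪u p.1, (U x : H →L[ℂ] H) ((R : H →L[ℂ] H) (v p.2))⟫_ℂ‖ ^ 2 := by
    intro u v hu hv
    refine Summable.of_nonneg_of_le (fun _ => sq_nonneg _) (fun p => ?_)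
      (hu.mul_of_nonneg hv (fun _ => sq_nonneg _) fun _ => sq_nonneg _)
    rw [← mul_pow]
    gcongr
    refine (norm_inner_le_norm _ _).trans ?_
    rw [norm_unitary_apply, norm_unitary_apply]
  have hs : Summable fun p : ℕ × ℕ =>
      ⟪a p.1, (U x : H →L[ℂ] H) ((R : H →L[ℂ] H) (d p.2))⟫_ℂ *
        ⟪(U x : H →L[ℂ] H) ((R : H →L[ℂ] H) (c p.2)), b p.1⟫_ℂ := by
    refine summable_mul_of_sq (hsq a d hA.left hB.right) ?_
    simp_rw [norm_inner_symm _ (b _)]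
    exact hsq b c hA.right hB.left
  have h1 : ∀ n, HasSum (fun k => ⟪a n, (U x : H →L[ℂ] H) ((R : H →L[ℂ] H) (d k))⟫_ℂ *
        ⟪(U x : H →L[ℂ] H) ((R : H →L[ℂ] H) (c k)), b n⟫_ℂ)
      ⟪a n, shift U x (reflect R B) (b n)⟫_ℂ := fun n => by
    rw [shift_reflect]
    exact (hB.conj ((U x : H →L[ℂ] H) * R)).hasSum _ _
  have h2 := hs.hasSum.prod_fiberwise h1
  have h3 := h2.unique (hA.hasSum_trace_mul (shift U x (reflect R B)))
  have h4 := hs.hasSum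
  rw [h3] at h4
  exact h4

variable [IsTopologicalAddGroup Ξ] [BorelSpace Ξ]

/-- Each term of the double series is integrable by the orthogonality relations, with summable `L¹`
norms, so the Fourier transform can be taken term by term. -/
theorem IsIrreducibleProjRep.integrable_opConvFun (hU : IsIrreducibleProjRep m U) {k : ℝ}
    (hk : ∀ φ a, MemLp (coeff U φ a) 2 μ ∧
      ∫ x, ‖coeff U φ a x‖ ^ 2 ∂μ = k * ‖φ‖ ^ 2 * ‖a‖ ^ 2)
    (horth : ∀ φ a ψ b, ∫ x, ⟪a, (U x : H →L[ℂ] H) φ⟫_ℂ * ⟪(U x : H →L[ℂ] H) ψ, b⟫_ℂ ∂μ =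
        k * ⟪a, b⟫_ℂ * ⟪ψ, φ⟫_ℂ)
    (hm : IsHeisenbergMultiplier m) (hR : IsReflection U R) {A B : H →L[ℂ] H}
    (hA : IsTraceClass A) (hB : IsTraceClass B) :
    Integrable (opConvFun U R A B) μ ∧ ∀ y, sympFourier μ m (opConvFun U R A B) y =
      k * reflPhase m y * (weylFourier U A y * weylFourier U B y) := by
  obtain ⟨a, b, hA⟩ := hA.exists_nuclearExpansion
  obtain ⟨c, d, hB⟩ := hB.exists_nuclearExpansion
  let F : ℕ × ℕ → Ξ → ℂ := fun p x =>
    ⟪a p.1, (U x : H →L[ℂ] H) ((R : H →L[ℂ] H) (d p.2))⟫_ℂ *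
        ⟪(U x : H →L[ℂ] H) ((R : H →L[ℂ] H) (c p.2)), b p.1⟫_ℂ
  have hmem : ∀ φ a, MemLp (fun x => ⟪a, (U x : H →L[ℂ] H) φ⟫_ℂ) 2 μ := fun φ a =>
    (memLp_congr_norm (continuous_const.inner (hU.continuous φ)).aestronglyMeasurable
      (hU.aestronglyMeasurable_coeff φ a) (.of_forall fun x => norm_inner_symm _ _)).2 (hk φ a).1
  have hFi : ∀ p, Integrable (F p) μ := fun p => (hmem _ _).integrable_mul (hk _ _).1
  have hFn : ∀ p, ∫ x, ‖F p x‖ ∂μ ≤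
      k * (‖d p.2‖ ^ 2 * ‖a p.1‖ ^ 2 + ‖c p.2‖ ^ 2 * ‖b p.1‖ ^ 2) := fun p => by
    have e1 := hk ((R : H →L[ℂ] H) (d p.2)) (a p.1)
    have e2 := hk ((R : H →L[ℂ] H) (c p.2)) (b p.1)
    rw [norm_unitary_apply] at e1 e2
    have e3 : k * (‖d p.2‖ ^ 2 * ‖a p.1‖ ^ 2 + ‖c p.2‖ ^ 2 * ‖b p.1‖ ^ 2) =
        k * ‖d p.2‖ ^ 2 * ‖a p.1‖ ^ 2 + k * ‖c p.2‖ ^ 2 * ‖b p.1‖ ^ 2 := by ring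
    rw [e3, ← e1.2, ← e2.2, ← integral_add (e1.1.integrable_norm_pow two_ne_zero)
      (e2.1.integrable_norm_pow two_ne_zero)]
    refine integral_mono (hFi p).norm ((e1.1.integrable_norm_pow two_ne_zero).add
      (e2.1.integrable_norm_pow two_ne_zero)) fun x => ?_
    refine (norm_mul_le_sq_add_sq _ _).trans (le_of_eq ?_)
    rw [norm_inner_symm (a p.1)]
    rfl
  have hprod : ∀ {u v : ℕ → H}, (Summable fun n => ‖u n‖ ^ 2) → (Summable fun n => ‖v n‖ ^ 2) →
      Summable fun p : ℕ × ℕ => ‖u p.2‖ ^ 2 * ‖v p.1‖ ^ 2 := fun {u v} hu hv => by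
    have h1 := hv.mul_of_nonneg hu (fun _ => sq_nonneg _) fun _ => sq_nonneg _
    exact h1.congr fun p => mul_comm _ _
  have hFs : Summable fun p => ∫ x, ‖F p x‖ ∂μ :=
    Summable.of_nonneg_of_le (fun p => integral_nonneg fun x => norm_nonneg _) hFn
      (((hprod hB.right hA.left).add (hprod hB.left hA.right)).mul_left k)
  have hsum : ∀ x, HasSum (fun p => F p x) (opConvFun U R A B x) := hasSum_opConvFun hA hB
  refine ⟨integrable_of_hasSum hFi hFs (.of_forall hsum), fun y => ?_⟩
  have h1 : HasSum (fun p => ∫ x, F p x * symp m y x ∂μ)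
      (sympFourier μ m (opConvFun U R A B) y) := by
    refine hasSum_integral_of_hasSum (F := fun p x => F p x * symp m y x)
      (f := fun x => opConvFun U R A B x * symp m y x)
      (fun p => integrable_circle_mul (hFi p) (hm.continuous_symp y)) ?_
      (.of_forall fun x => (hsum x).mul_right _)
    simpa only [norm_mul, Circle.norm_coe, mul_one] using hFs
  have hA1 := hA.hasSum_trace_mul (U y : H →L[ℂ] H)
  have hB1 := hB.hasSum_trace_mul (U y : H →L[ℂ] H)
  have h2 := (hasSum_mul_of_summable_norm (u := fun n => ⟪a n, (U y : H →L[ℂ] H) (b n)⟫_ℂ)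
    (v := fun n => ⟪c n, (U y : H →L[ℂ] H) (d n)⟫_ℂ) hA1 hB1 hA1.summable.norm
    hB1.summable.norm).mul_left (k * reflPhase m y : ℂ)
  have e : (fun p => ∫ x, F p x * symp m y x ∂μ) = fun p : ℕ × ℕ => (k * reflPhase m y : ℂ) *
      (⟪a p.1, (U y : H →L[ℂ] H) (b p.1)⟫_ℂ * ⟪c p.2, (U y : H →L[ℂ] H) (d p.2)⟫_ℂ) := by
    funext p
    have e1 : ∀ x, F p x * symp m y x = ⟪star (U y : H →L[ℂ] H) (a p.1), (U x : H →L[ℂ] H)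
        (star (U y : H →L[ℂ] H) ((R : H →L[ℂ] H) (d p.2)))⟫_ℂ *
        ⟪(U x : H →L[ℂ] H) ((R : H →L[ℂ] H) (c p.2)), b p.1⟫_ℂ := fun x => by
      rw [← hU.symp_mul_inner]
      ring
    simp_rw [e1]
    -- After orthogonality the second factor is `⟨U_y R c, R d⟩ = ⟨U_{-y} c, d⟩`, where `R`
    -- disappears; `U_{-y}*` is `U_y` up to the phase `reflPhase m y`.
    rw [horth, inner_star_unitary_apply, inner_star_unitary_apply_right, hR.apply_apply,
      inner_unitary_unitary, ← inner_star_unitary_apply_right, hU.star_neg_apply, inner_smul_right]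
    ring
  rw [e] at h1
  exact h1.unique h2

end Transforms

/-! ### Function-operator convolution and injectivity of the Weyl transform -/

section FunOp

variable {Ξ : Type*} [AddCommGroup Ξ] [TopologicalSpace Ξ] [IsTopologicalAddGroup Ξ] [T2Space Ξ]
  [LocallyCompactSpace Ξ] [MeasurableSpace Ξ] [BorelSpace Ξ] {μ : Measure Ξ}
  {H : Type*} [NormedAddCommGroup H] [InnerProductSpace ℂ H] [CompleteSpace H]
  {m : Ξ → Ξ → Circle} {U : Ξ → unitary (H →L[ℂ] H)} {R : unitary (H →L[ℂ] H)}

theorem norm_shift_le (A : H →L[ℂ] H) (x : Ξ) : ‖shift U x A‖ ≤ ‖A‖ := by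
  refine ContinuousLinearMap.opNorm_le_bound _ (norm_nonneg _) fun v => ?_
  unfold shift
  rw [mul_apply_eq_comp, mul_apply_eq_comp, norm_unitary_apply]
  refine (A.le_opNorm _).trans (le_of_eq ?_)
  rw [← norm_unitary_apply (U x), unitary_apply_star_apply]

theorem continuous_rankOne {X : Type*} [TopologicalSpace X] {u v : X → H} (hu : Continuous u)
    (hv : Continuous v) : Continuous fun x => InnerProductSpace.rankOne ℂ (u x) (v x) :=
  ((ContinuousLinearMap.toSpanSingletonCLE (𝕜 := ℂ) (E := H)).continuous.comp hu).clm_comp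
    ((innerSL ℂ).continuous.comp hv)

/-- Strong continuity of `U` gives norm continuity for rank one operators, and the nuclear series
converges uniformly in `x`. -/
theorem IsIrreducibleProjRep.continuous_shift (hU : IsIrreducibleProjRep m U) {A : H →L[ℂ] H}
    (hA : IsTraceClass A) : Continuous fun x => shift U x A := by
  obtain ⟨a, b, h⟩ := hA.exists_nuclearExpansion
  have hn : ∀ n x, ‖InnerProductSpace.rankOne ℂ ((U x : H →L[ℂ] H) (b n))
      ((U x : H →L[ℂ] H) (a n))‖ ≤ ‖b n‖ ^ 2 + ‖a n‖ ^ 2 := fun n x => by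
    rw [InnerProductSpace.norm_rankOne, norm_unitary_apply, norm_unitary_apply]
    nlinarith [sq_nonneg (‖b n‖ - ‖a n‖), norm_nonneg (a n), norm_nonneg (b n)]
  have hs := h.right.add h.left
  have e : (fun x => shift U x A) = fun x => ∑' n, InnerProductSpace.rankOne ℂ
      ((U x : H →L[ℂ] H) (b n)) ((U x : H →L[ℂ] H) (a n)) := by
    funext x
    ext v
    refine ext_inner_left ℂ fun u => ?_
    have h1 := (Summable.of_norm_bounded hs fun n => hn n x).hasSum
    have h2 := (innerSL ℂ u).hasSum ((ContinuousLinearMap.apply ℂ H v).hasSum h1)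
    have h3 := (h.conj (U x : H →L[ℂ] H)).hasSum u v
    refine h3.unique (HasSum.congr_fun h2 fun n => ?_)
    simp [mul_comm]
  rw [e]
  refine continuous_tsum (fun n => ?_) hs hn
  exact continuous_rankOne (hU.continuous (b n)) (hU.continuous (a n))

/-- Strong measurability needs care, as `Ξ` may be large. With `f` replaced by a compactly supported
continuous function the integrand is continuous with compact support, and the series for `f` does
the rest. -/
theorem IsIrreducibleProjRep.integrable_smul_shift [μ.IsAddHaarMeasure] [μ.Regular]
    (hU : IsIrreducibleProjRep m U) {f : Ξ → ℂ}
    (hf : Integrable f μ) {A : H →L[ℂ] H} (hA : IsTraceClass A) :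
    Integrable (fun x => f x • shift U x A) μ := by
  obtain ⟨φ, hφc, hφs, hφi, hφ, hφf⟩ := exists_hasSum_continuous hf
  have hi : ∀ n, Integrable (fun x => φ n x • shift U x A) μ := fun n =>
    ((hφc n).smul (hU.continuous_shift hA)).integrable_of_hasCompactSupport (hφs n).smul_right
  refine integrable_of_hasSum hi ?_ (hφf.mono fun x hx => hx.smul_const _)
  refine Summable.of_nonneg_of_le (fun n => integral_nonneg fun x => norm_nonneg _) (fun n => ?_)
    (hφ.mul_right ‖A‖)
  rw [← integral_mul_const]
  refine integral_mono (hi n).norm ((hφi n).norm.mul_const _) fun x => ?_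
  simp only [norm_smul]
  gcongr
  exact norm_shift_le A x

theorem inner_funOpConv {f : Ξ → ℂ} {A : H →L[ℂ] H}
    (h : Integrable (fun x => f x • shift U x A) μ) (u v : H) :
    ⟪u, funOpConv μ U f A v⟫_ℂ = ∫ x, f x * ⟪u, shift U x A v⟫_ℂ ∂μ := by
  have h1 := ((innerSL ℂ u).comp (ContinuousLinearMap.apply ℂ H v)).integral_comp_comm h
  unfold funOpConv
  simpa using h1.symm

/-- All shifts of `A` satisfy the bounded-sums criterion with the same constant `M`; integrating
against `|f|` gives the constant `‖f‖₁ M`. -/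
theorem IsIrreducibleProjRep.isTraceClass_funOpConv [μ.IsAddHaarMeasure] [μ.Regular]
    (hU : IsIrreducibleProjRep m U) {f : Ξ → ℂ}
    (hf : Integrable f μ) {A : H →L[ℂ] H} (hA : IsTraceClass A) :
    IsTraceClass (funOpConv μ U f A) := by
  have hi := hU.integrable_smul_shift hf hA
  have hcont := hU.continuous_shift hA
  obtain ⟨a, b, h⟩ := hA.exists_nuclearExpansion
  set M := ∑' n, (‖b n‖ ^ 2 + ‖a n‖ ^ 2) with hM
  rw [isTraceClass_iff_bounded]
  refine ⟨(∫ x, ‖f x‖ ∂μ) * M, fun X hX s => ?_⟩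
  have hint : ∀ u v : H, Integrable (fun x => f x * ⟪u, shift U x A v⟫_ℂ) μ := fun u v => by
    have h1 := ((innerSL ℂ u).comp (ContinuousLinearMap.apply ℂ H v)).integrable_comp hi
    simpa [inner_smul_right] using h1
  calc ∑ i ∈ s, ‖⟪X (onb H i), funOpConv μ U f A (onb H i)⟫_ℂ‖
      ≤ ∑ i ∈ s, ∫ x, ‖f x * ⟪X (onb H i), shift U x A (onb H i)⟫_ℂ‖ ∂μ := by
        refine Finset.sum_le_sum fun i _ => ?_
        rw [inner_funOpConv hi]
        exact norm_integral_le_integral_norm _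
    _ = ∫ x, ∑ i ∈ s, ‖f x * ⟪X (onb H i), shift U x A (onb H i)⟫_ℂ‖ ∂μ :=
        (integral_finsetSum s fun i _ => (hint _ _).norm).symm
    _ ≤ ∫ x, ‖f x‖ * M ∂μ := by
        refine integral_mono (integrable_finsetSum s fun i _ => (hint _ _).norm)
          (hf.norm.mul_const _) fun x => ?_
        simp only [norm_mul]
        rw [← Finset.mul_sum]
        gcongr
        have h1 := (h.conj (U x : H →L[ℂ] H)).sum_norm_inner_le hX s
        simp only [norm_unitary_apply] at h1
        exact h1
    _ = _ := integral_mul_const _ _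

/-- The one instance of associativity that is checked by hand: in `U_z* U_x`, which is `U_{x-z}` up
to a phase, the phase occurs once conjugated and once not. -/
theorem IsIrreducibleProjRep.opConvFun_funOpConv_rankOne [μ.IsAddHaarMeasure] [μ.Regular]
    (hU : IsIrreducibleProjRep m U)
    {f : Ξ → ℂ} {A : H →L[ℂ] H} (h : Integrable (fun x => f x • shift U x A) μ) (c d : H) :
    opConvFun U R (funOpConv μ U f A) (InnerProductSpace.rankOne ℂ d c) =
      f ⋆[ContinuousLinearMap.mul ℂ ℂ, μ] opConvFun U R A (InnerProductSpace.rankOne ℂ d c) := by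
  funext x
  rw [convolution_mul_apply, opConvFun_rankOne, inner_funOpConv h]
  refine integral_congr_ae (.of_forall fun z => ?_)
  simp only [opConvFun_rankOne]
  congr 1
  unfold shift
  rw [mul_apply_eq_comp, mul_apply_eq_comp, ← inner_star_unitary_apply, hU.star_mul_eq_smul,
    hU.star_mul_eq_smul, map_smul, inner_smul_right, inner_circle_smul_left, ← mul_assoc,
    ← Circle.coe_mul, mul_inv_cancel, Circle.coe_one, one_mul]

/-- Take transforms in `(f ∗ A) ∗ B = f ∗ (A ∗ B)` for a rank one `B` and cancel the common factor,
so that no trace has to be exchanged with the operator integral. -/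
theorem IsIrreducibleProjRep.weylFourier_funOpConv [μ.IsAddHaarMeasure] [μ.Regular]
    (hU : IsIrreducibleProjRep m U) (hsq : IsSquareIntegrable μ U)
    (hm : IsHeisenbergMultiplier m) (hR : IsReflection U R) {f : Ξ → ℂ} (hf : Integrable f μ)
    {A : H →L[ℂ] H} (hA : IsTraceClass A) (y : Ξ) :
    weylFourier U (funOpConv μ U f A) y = sympFourier μ m f y * weylFourier U A y := by
  obtain ⟨k, hk0, hk, horth⟩ := hU.exists_orthogonality hsq
  have := hU.nontrivial
  obtain ⟨d, hd⟩ := exists_ne (0 : H)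
  -- With this choice the transform of `B` at the given `y` is `‖d‖²`, which allows the
  -- cancellation.
  set c := (U y : H →L[ℂ] H) d with hc
  have hB : IsTraceClass (InnerProductSpace.rankOne ℂ d c) :=
    (nuclearExpansion_rankOne c d).isTraceClass
  have hT := hU.isTraceClass_funOpConv hf hA
  have h1 := (hU.integrable_opConvFun hk horth hm hR hT hB).2 y
  obtain ⟨h2, h3⟩ := hU.integrable_opConvFun hk horth hm hR hA hB
  have h4 := (convolution_integrable hf h2).2.2 (symp m y) (hm.continuous_symp y)
    (hm.symp_add_right y)
  rw [← hU.opConvFun_funOpConv_rankOne (hU.integrable_smul_shift hf hA)] at h4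
  have h5 := h1.symm.trans (h4.trans (congrArg (sympFourier μ m f y * ·) (h3 y)))
  have hne : (k * reflPhase m y : ℂ) * weylFourier U (InnerProductSpace.rankOne ℂ d c) y ≠ 0 := by
    rw [weylFourier_rankOne, hc, inner_self_eq_ofReal, norm_unitary_apply]
    refine mul_ne_zero (mul_ne_zero (by exact_mod_cast hk0) (Circle.coe_ne_zero _)) ?_
    exact_mod_cast pow_ne_zero 2 (norm_ne_zero_iff.2 hd)
  refine mul_right_cancel₀ hne ?_
  linear_combination h5

/-- If the transform of `A` vanishes, so does that of `A ∗ B`; for rank one `B` this function is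
continuous, hence zero everywhere. -/
theorem IsIrreducibleProjRep.eq_zero_of_weylFourier_eq_zero [μ.IsAddHaarMeasure] [μ.Regular]
    (hU : IsIrreducibleProjRep m U) (hsq : IsSquareIntegrable μ U)
    (hm : IsHeisenbergMultiplier m) (hR : IsReflection U R)
    {A : H →L[ℂ] H} (hA : IsTraceClass A) (h0 : ∀ y, weylFourier U A y = 0) : A = 0 := by
  obtain ⟨k, hk0, hk, horth⟩ := hU.exists_orthogonality hsq
  ext d
  refine ext_inner_left ℂ fun c => ?_
  -- Moving the test vectors by `(U_0 R)*` makes the value of the convolution at `0` equal to `⟨c, A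
  -- d⟩`.
  set W : unitary (H →L[ℂ] H) := U 0 * R with hW
  set c' := star (W : H →L[ℂ] H) c with hc'
  set d' := star (W : H →L[ℂ] H) d with hd'
  have hB : IsTraceClass (InnerProductSpace.rankOne ℂ d' c') :=
    (nuclearExpansion_rankOne c' d').isTraceClass
  obtain ⟨h2, h3⟩ := hU.integrable_opConvFun hk horth hm hR hA hB
  have hz := ae_eq_zero_of_integral_mul_char_eq_zero hm.continuous_symp hm.symp_add_left
    hm.eq_of_symp_eq h2 fun y => (h3 y).trans (by rw [h0, zero_mul, mul_zero])
  have hcont : Continuous (opConvFun U R A (InnerProductSpace.rankOne ℂ d' c')) := by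
    rw [funext (opConvFun_rankOne A c' d')]
    exact (hU.continuous _).inner (A.continuous.comp (hU.continuous _))
  have h5 := congrFun ((Continuous.ae_eq_iff_eq μ hcont continuous_zero).1 hz) 0
  rw [opConvFun_rankOne] at h5
  have h6 : ∀ v, (U 0 : H →L[ℂ] H) ((R : H →L[ℂ] H) (star (W : H →L[ℂ] H) v)) = v := fun v =>
    unitary_apply_star_apply W v
  rw [hc', hd', h6, h6] at h5
  rw [h5]
  simp

end FunOp

/-! ### Transforms of the convolution on the direct sum -/

section Algebra

variable {Ξ : Type*} [AddCommGroup Ξ] [TopologicalSpace Ξ] [MeasurableSpace Ξ] [BorelSpace Ξ]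
  {μ : Measure Ξ}
  {H : Type*} [NormedAddCommGroup H] [InnerProductSpace ℂ H] [CompleteSpace H]
  {m : Ξ → Ξ → Circle} {U : Ξ → unitary (H →L[ℂ] H)} {R : unitary (H →L[ℂ] H)}

theorem sympFourier_congr {f g : Ξ → ℂ} (h : f =ᵐ[μ] g) (y : Ξ) :
    sympFourier μ m f y = sympFourier μ m g y :=
  integral_congr_ae (h.mono fun x hx => congrArg (· * (symp m y x : ℂ)) hx)

theorem IsHeisenbergMultiplier.sympFourier_add (hm : IsHeisenbergMultiplier m) (f g : Lp ℂ 1 μ)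
    (y : Ξ) : sympFourier μ m (f + g : Lp ℂ 1 μ) y = sympFourier μ m f y + sympFourier μ m g y := by
  rw [sympFourier_congr (Lp.coeFn_add f g)]
  unfold sympFourier
  rw [← integral_add (integrable_circle_mul (L1.integrable_coeFn f) (hm.continuous_symp y))
    (integrable_circle_mul (L1.integrable_coeFn g) (hm.continuous_symp y))]
  simp only [Pi.add_apply, add_mul]

theorem sympFourier_smul (c : ℂ) (f : Lp ℂ 1 μ) (y : Ξ) :
    sympFourier μ m (c • f : Lp ℂ 1 μ) y = c * sympFourier μ m f y := by
  rw [sympFourier_congr (Lp.coeFn_smul c f)]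
  unfold sympFourier
  rw [← integral_const_mul]
  simp only [Pi.smul_apply, smul_eq_mul, mul_assoc]

theorem sympFourier_toL1 {f : Ξ → ℂ} (hf : Integrable f μ) (y : Ξ) :
    sympFourier μ m (toL1 μ f) y = sympFourier μ m f y := by
  rw [toL1, dif_pos hf]
  exact sympFourier_congr hf.coeFn_toL1 y

theorem weylFourier_add {A B : H →L[ℂ] H} (hA : IsTraceClass A) (hB : IsTraceClass B) (y : Ξ) :
    weylFourier U (A + B) y = weylFourier U A y + weylFourier U B y := by
  unfold weylFourier
  rw [add_mul, trace_add (hA.mul_right _) (hB.mul_right _)]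

theorem weylFourier_smul (c : ℂ) (A : H →L[ℂ] H) (y : Ξ) :
    weylFourier U (c • A) y = c * weylFourier U A y := by
  unfold weylFourier
  rw [smul_mul_assoc, trace_smul]

theorem coe_toTraceClass {A : H →L[ℂ] H} (hA : IsTraceClass A) :
    (toTraceClass A : H →L[ℂ] H) = A := by
  rw [toTraceClass, dif_pos hA]

variable [IsTopologicalAddGroup Ξ] [T2Space Ξ] [LocallyCompactSpace Ξ] [μ.IsAddHaarMeasure]
  [μ.Regular]

/-- The pair of Fourier transforms is injective on `L¹ ⊕ 𝒯¹`. -/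
theorem IsIrreducibleProjRep.ext_fourier (hU : IsIrreducibleProjRep m U)
    (hsq : IsSquareIntegrable μ U) (hm : IsHeisenbergMultiplier m) (hR : IsReflection U R)
    {p q : Lp ℂ 1 μ × traceClass H}
    (h1 : ∀ y, sympFourier μ m p.1 y = sympFourier μ m q.1 y)
    (h2 : ∀ y, weylFourier U (p.2 : H →L[ℂ] H) y = weylFourier U (q.2 : H →L[ℂ] H) y) : p = q := by
  have hsub : ∀ r s : Lp ℂ 1 μ × traceClass H, r - s = r + (-1 : ℂ) • s := fun r s => by
    rw [neg_one_smul ℂ s, sub_eq_add_neg]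
  rw [← sub_eq_zero]
  refine Prod.ext ?_ (Subtype.ext ?_)
  · refine (Lp.eq_zero_iff_ae_eq_zero (f := (p - q).1)).2 ?_
    refine ae_eq_zero_of_integral_mul_char_eq_zero hm.continuous_symp hm.symp_add_left
      hm.eq_of_symp_eq (L1.integrable_coeFn _) fun y => ?_
    change sympFourier μ m (p - q).1 y = 0
    rw [hsub, Prod.fst_add, hm.sympFourier_add, Prod.smul_fst, sympFourier_smul, h1]
    ring
  · refine hU.eq_zero_of_weylFourier_eq_zero hsq hm hR (p - q).2.2 fun y => ?_
    rw [hsub, Prod.snd_add, Submodule.coe_add, weylFourier_add p.2.2 ((-1 : ℂ) • q).2.2,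
      Prod.smul_snd, Submodule.coe_smul, weylFourier_smul, h2]
    ring

/-- Fourier transforms turn the convolution into a product. -/
theorem IsIrreducibleProjRep.exists_fourier_conv (hU : IsIrreducibleProjRep m U)
    (hsq : IsSquareIntegrable μ U) (hm : IsHeisenbergMultiplier m) (hR : IsReflection U R) :
    ∃ κ : Ξ → ℂ, ∀ (p q : Lp ℂ 1 μ × traceClass H) (y : Ξ),
      sympFourier μ m (conv μ U R p q).1 y =
        sympFourier μ m p.1 y * sympFourier μ m q.1 y +
          κ y * (weylFourier U (p.2 : H →L[ℂ] H) y * weylFourier U (q.2 : H →L[ℂ] H) y) ∧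
      weylFourier U ((conv μ U R p q).2 : H →L[ℂ] H) y =
        sympFourier μ m p.1 y * weylFourier U (q.2 : H →L[ℂ] H) y +
          sympFourier μ m q.1 y * weylFourier U (p.2 : H →L[ℂ] H) y := by
  obtain ⟨k, -, hk, horth⟩ := hU.exists_orthogonality hsq
  refine ⟨fun y => k * reflPhase m y, fun p q y => ⟨?_, ?_⟩⟩
  -- Integrability here, and the trace class property below, exclude the default value `0` of `toL1`
  -- and `toTraceClass`.
  · obtain ⟨-, h1, h2⟩ := convolution_integrable (L1.integrable_coeFn p.1) (L1.integrable_coeFn q.1)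
    obtain ⟨h3, h4⟩ := hU.integrable_opConvFun hk horth hm hR p.2.2 q.2.2
    rw [conv, hm.sympFourier_add, sympFourier_toL1 h1, sympFourier_toL1 h3, h4]
    congr 1
    exact h2 (symp m y) (hm.continuous_symp y) (hm.symp_add_right y)
  · have h1 := hU.isTraceClass_funOpConv (L1.integrable_coeFn p.1) q.2.2
    have h2 := hU.isTraceClass_funOpConv (L1.integrable_coeFn q.1) p.2.2
    rw [conv, Submodule.coe_add, coe_toTraceClass h1, coe_toTraceClass h2, weylFourier_add h1 h2,
      hU.weylFourier_funOpConv hsq hm hR (L1.integrable_coeFn p.1) q.2.2,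
      hU.weylFourier_funOpConv hsq hm hR (L1.integrable_coeFn q.1) p.2.2]

end Algebra

end QHA

end

theorem mainTheorem8
    {Ξ : Type*} [AddCommGroup Ξ] [TopologicalSpace Ξ] [IsTopologicalAddGroup Ξ] [T2Space Ξ]
    [LocallyCompactSpace Ξ] [MeasurableSpace Ξ] [BorelSpace Ξ]
    (μ : MeasureTheory.Measure Ξ) [μ.IsAddHaarMeasure] [μ.Regular]
    {H : Type*} [NormedAddCommGroup H] [InnerProductSpace ℂ H] [CompleteSpace H]
    (m : Ξ → Ξ → Circle) (hm : QHA.IsHeisenbergMultiplier m)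
    (hsymm : ∀ x y, m x y = m (-x) (-y))
    (U : Ξ → unitary (H →L[ℂ] H)) (hU : QHA.IsIrreducibleProjRep m U)
    (hsq : QHA.IsSquareIntegrable μ U) :
    -- the reflection operator exists, and what follows holds for every choice of it
    (∃ R : unitary (H →L[ℂ] H), QHA.IsReflection U R) ∧
    ∀ R : unitary (H →L[ℂ] H), QHA.IsReflection U R →
      -- the three convolutions are well defined
      (∀ f g : Lp ℂ 1 μ,
        (∀ᵐ y ∂μ, ConvolutionExistsAt f g y (ContinuousLinearMap.mul ℂ ℂ) μ) ∧
        Integrable (f ⋆[ContinuousLinearMap.mul ℂ ℂ, μ] g) μ) ∧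
      (∀ A B : QHA.traceClass H,
        (∀ x, QHA.IsTraceClass ((A : H →L[ℂ] H) * QHA.shift U x (QHA.reflect R B))) ∧
        Integrable (QHA.opConvFun U R A B) μ) ∧
      (∀ (f : Lp ℂ 1 μ) (A : QHA.traceClass H),
        Integrable (fun x => f x • QHA.shift U x (A : H →L[ℂ] H)) μ ∧
        QHA.IsTraceClass (QHA.funOpConv μ U f (A : H →L[ℂ] H))) ∧
      -- the convolution is commutative and associative
      (∀ p q : Lp ℂ 1 μ × QHA.traceClass H, QHA.conv μ U R p q = QHA.conv μ U R q p) ∧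
      (∀ p q r : Lp ℂ 1 μ × QHA.traceClass H,
        QHA.conv μ U R (QHA.conv μ U R p q) r = QHA.conv μ U R p (QHA.conv μ U R q r)) ∧
      -- it is distributive and compatible with scalars
      (∀ p q r : Lp ℂ 1 μ × QHA.traceClass H,
        QHA.conv μ U R p (q + r) = QHA.conv μ U R p q + QHA.conv μ U R p r) ∧
      (∀ p q r : Lp ℂ 1 μ × QHA.traceClass H,
        QHA.conv μ U R (p + q) r = QHA.conv μ U R p r + QHA.conv μ U R q r) ∧
      (∀ (c : ℂ) (p q : Lp ℂ 1 μ × QHA.traceClass H),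
        QHA.conv μ U R (c • p) q = c • QHA.conv μ U R p q) ∧
      (∀ (c : ℂ) (p q : Lp ℂ 1 μ × QHA.traceClass H),
        QHA.conv μ U R p (c • q) = c • QHA.conv μ U R p q) := by
  refine ⟨QHA.exists_isReflection hm hsymm hU hsq, fun R hR => ?_⟩
  obtain ⟨k, -, hk, horth⟩ := hU.exists_orthogonality hsq
  obtain ⟨κ, hκ⟩ := hU.exists_fourier_conv hsq hm hR
  have hadd : ∀ (p q : Lp ℂ 1 μ × QHA.traceClass H) (y : Ξ),
      QHA.sympFourier μ m (p + q).1 y =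
        QHA.sympFourier μ m p.1 y + QHA.sympFourier μ m q.1 y ∧
      QHA.weylFourier U ((p + q).2 : H →L[ℂ] H) y =
        QHA.weylFourier U (p.2 : H →L[ℂ] H) y + QHA.weylFourier U (q.2 : H →L[ℂ] H) y :=
    fun p q y => ⟨hm.sympFourier_add _ _ y, QHA.weylFourier_add p.2.2 q.2.2 y⟩
  have hsmul : ∀ (c : ℂ) (p : Lp ℂ 1 μ × QHA.traceClass H) (y : Ξ),
      QHA.sympFourier μ m (c • p).1 y = c * QHA.sympFourier μ m p.1 y ∧
      QHA.weylFourier U ((c • p).2 : H →L[ℂ] H) y = c * QHA.weylFourier U (p.2 : H →L[ℂ] H) y :=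
    fun c p y => ⟨QHA.sympFourier_smul c _ y, QHA.weylFourier_smul c _ y⟩
  refine ⟨fun f g => ?_, fun A B => ⟨fun x => QHA.isTraceClass_opConv A.2 B x, ?_⟩,
    fun f A => ⟨?_, ?_⟩, fun p q => ?_, fun p q r => ?_, fun p q r => ?_, fun p q r => ?_,
    fun c p q => ?_, fun c p q => ?_⟩
  · have h := QHA.convolution_integrable (L1.integrable_coeFn f) (L1.integrable_coeFn g)
    exact ⟨h.1, h.2.1⟩
  · exact (hU.integrable_opConvFun hk horth hm hR A.2 B.2).1
  · exact hU.integrable_smul_shift (L1.integrable_coeFn f) A.2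
  · exact hU.isTraceClass_funOpConv (L1.integrable_coeFn f) A.2
  -- By injectivity of the transforms each remaining law is checked at a single `y`, where it is a
  -- polynomial identity in the values of the transforms and `κ y`.
  all_goals
    refine hU.ext_fourier hsq hm hR (fun y => ?_) fun y => ?_
    all_goals
      simp only [(hκ _ _ y).1, (hκ _ _ y).2, (hadd _ _ y).1, (hadd _ _ y).2, (hsmul _ _ y).1,
        (hsmul _ _ y).2]
      ring
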